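/- For integers $\mu,n\ge 0$ let $B_n^{(\mu)}(z)$ be the generalised Bernoulli polynomials, defined by $\left(\frac{t}{e^t-1}\right)^{\mu}e^{zt}=\sum_{n\ge 0}B_n^{(\mu)}(z)\frac{t^n}{n!}$. Let $x>1$ be real and fixed, put $h=\frac{x}{x-1}$, $s_0=\log h$ and $\psi(s)=\log(e^s-1)-xs$ (principal logarithm, for $s$ near $s_0$). There is an analytic function $s=s(w)$ near $w=0$ with $$\psi(s(w))-\psi(s_0)=\tfrac12 w^2,\qquad s(0)=s_0,\qquad s'(0)=\frac{i(h-1)}{h^{1/2}},$$ and its germ at $w=0$ determines real numbers $A_k=A_k(h,s_0)$, $k\ge 0$, through the even part of the Taylor expansion $$\frac1s\frac{ds}{dw}\ \text{(even powers of } w \text{ only)}=\frac{i(h-1)}{s_0h^{1/2}}\sum_{k\ge 0}A_k(h,s_0)\,w^{2k}.$$ Here $A_0=1$, and with $\lambda=s_0$ $$A_1=\frac1{12h}\Big\{-(1-h+h^2)+\frac{6(h^2-1)}{\lambda}-\frac{12(h-1)^2}{\lambda^2}\Big\},$$ $$A_2=\frac1{864h^2}\Big\{(1-h+h^2)^2-\frac{12}{\lambda}(h^2-1)(3-5h+3h^2)+\frac{120}{\lambda^2}(h-1)^2(2+h+2h^2)-\frac{720}{\lambda^3}(h+1)(h-1)^3+\frac{864}{\lambda^4}(h-1)^4\Big\},$$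 $$A_3=\frac1{777600h^3}\Big\{\Upsilon(h)+\frac{90}{\lambda}(h^2-1)(1-h+h^2)(5-9h+5h^2)-\frac{1260}{\lambda^2}(h-1)^2(13-8h-3h^2-8h^3+13h^4)$$ $$\qquad+\frac{15120}{\lambda^3}(h-1)^3(h+1)(8-5h+8h^2)-\frac{453600}{\lambda^4}(h-1)^4(1+h+h^2)+\frac{907200}{\lambda^5}(h-1)^5(h+1)-\frac{777600}{\lambda^6}(h-1)^6\Big\},$$ where $\Upsilon(h)=139-417h+402h^2-109h^3+402h^4-417h^5+139h^6$. Then, as $n\to\infty$, $$B_n^{(n)}(nx)\sim\frac{n!}{\sqrt{2\pi n}}\,\frac{(x-1)^{n-1}}{\log(x/(x-1))}\Big(\frac{x}{x-1}\Big)^{nx-1/2}\sum_{k=0}^\infty\frac{2^k(\frac12)_k}{n^k}A_k(h,s_0),$$ where $(a)_k=a(a+1)\cdots(a+k-1)$; this means that, for every integer $N\ge 0$, if the series is truncated to the terms $k<N$, the difference of the two sides is $O(n^{-N})$ times the factor in front of the sum. -/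

import Mathlib

noncomputable section

/-- The value at `z` of the generalised Bernoulli polynomial `B_n^{(μ)}` of order `μ ∈ ℕ`:
`(t / (e^t - 1))^μ e^{zt} = ∑ B_n^{(μ)}(z) t^n / n!`. Here `bernoulliPowerSeries ℝ` is the power
series of `t / (e^t - 1)` (its product with `exp ℝ - 1` is `X`), and `rescale z (exp ℝ)` is that of
`e^{zt}`. -/
def genBernoulli (μ n : ℕ) (z : ℝ) : ℝ :=
  (n.factorial : ℝ) *
    PowerSeries.coeff n
      ((bernoulliPowerSeries ℝ) ^ μ * PowerSeries.rescale z (PowerSeries.exp ℝ))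

/-- The phase function `ψ(s) = log (e^s - 1) - s z`. The principal logarithm is only used
near the positive real axis. -/
def phase (z s : ℂ) : ℂ := Complex.log (Complex.exp s - 1) - s * z

/-- `h = x / (x - 1)`. -/
def hPar (x : ℝ) : ℝ := x / (x - 1)

/-- The saddle point `s₀ = log h`. -/
def saddlePt (x : ℝ) : ℝ := Real.log (hPar x)

/-- `s` is the inversion near the saddle point of the change of variables
`ψ(s) - ψ(s₀) = w² / 2`: an analytic function of `w` near `w = 0` with `s(0) = s₀`, on the
branch given by `s'(0) = i (h - 1) / √h`. -/
structure IsSaddleInverse (x : ℝ) (s : ℂ → ℂ) : Prop where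
  analyticAt : AnalyticAt ℂ s 0
  map_zero : s 0 = (saddlePt x : ℂ)
  deriv_zero : deriv s 0 = Complex.I * (((hPar x - 1) / √(hPar x) : ℝ) : ℂ)
  phase_eq : ∀ᶠ w in nhds (0 : ℂ),
    phase (x : ℂ) (s w) - phase (x : ℂ) (saddlePt x : ℂ) = w ^ 2 / 2

/-- The Taylor coefficient at `w = 0` of `w ^ m` in `(1 / s) ds / dw`. -/
def logDerivCoeff (s : ℂ → ℂ) (m : ℕ) : ℂ :=
  iteratedDeriv m (fun w => (1 / s w) * deriv s w) 0 / (m.factorial : ℂ)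

/-- The explicit first coefficient `A₁(h, λ)`. -/
def explicitA1 (h l : ℝ) : ℝ :=
  1 / (12 * h) * (-(1 - h + h ^ 2) + 6 * (h ^ 2 - 1) / l - 12 * (h - 1) ^ 2 / l ^ 2)

/-- The explicit second coefficient `A₂(h, λ)`. -/
def explicitA2 (h l : ℝ) : ℝ :=
  1 / (864 * h ^ 2) *
    ((1 - h + h ^ 2) ^ 2 - 12 / l * (h ^ 2 - 1) * (3 - 5 * h + 3 * h ^ 2)
      + 120 / l ^ 2 * (h - 1) ^ 2 * (2 + h + 2 * h ^ 2)
      - 720 / l ^ 3 * (h + 1) * (h - 1) ^ 3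
      + 864 / l ^ 4 * (h - 1) ^ 4)

/-- The explicit third coefficient `A₃(h, λ)`. -/
def explicitA3 (h l : ℝ) : ℝ :=
  1 / (777600 * h ^ 3) *
    ((139 - 417 * h + 402 * h ^ 2 - 109 * h ^ 3 + 402 * h ^ 4 - 417 * h ^ 5 + 139 * h ^ 6)
      + 90 / l * (h ^ 2 - 1) * (1 - h + h ^ 2) * (5 - 9 * h + 5 * h ^ 2)
      - 1260 / l ^ 2 * (h - 1) ^ 2 * (13 - 8 * h - 3 * h ^ 2 - 8 * h ^ 3 + 13 * h ^ 4)
      + 15120 / l ^ 3 * (h - 1) ^ 3 * (h + 1) * (8 - 5 * h + 8 * h ^ 2)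
      - 453600 / l ^ 4 * (h - 1) ^ 4 * (1 + h + h ^ 2)
      + 907200 / l ^ 5 * (h - 1) ^ 5 * (h + 1)
      - 777600 / l ^ 6 * (h - 1) ^ 6)

/-- The prefactor
`n! / √(2πn) · (x - 1)^(n - 1) / log (x / (x - 1)) · (x / (x - 1))^(n x - 1 / 2)`. -/
def prefactor (x : ℝ) (n : ℕ) : ℝ :=
  (n.factorial : ℝ) / √(2 * Real.pi * n)
    * ((x - 1) ^ ((n : ℤ) - 1) / Real.log (x / (x - 1)))
    * (x / (x - 1)) ^ ((n : ℝ) * x - 1 / 2)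

end

/-! ### Taylor coefficients and the Bernoulli generating function -/

noncomputable section
-- The proof is the method of steepest descent. By the residue theorem `B_n^{(n)}(nx) / n!` is `1 /
-- (2πi)` times a contour integral of `exp(-n ψ(t)) / t` around the origin. Since `ψ' = e^t / (e^t -
-- 1) - x` and `x = h / (h - 1)`, the point `s₀ = log h` is a saddle. The contour is the boundary of
-- `[-1, s₀] × [-π, π]`, whose right side crosses the real axis there. With `saddleRatio = exp(ψ(s₀)
-- - ψ)`, the modulus is below `1` on the whole boundary except at `s₀`, so by compactness
-- everything outside a short vertical segment through `s₀` is geometrically small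
-- (`geomSmall_sub_saddleIntegral`).
--
-- On that segment the coordinate `w` with `ψ - ψ(s₀) = w² / 2` turns the integrand into `exp(-n w²
-- / 2) s'(w) / s(w)`. Primitives on a disc replace the curved path by a real interval, at a
-- geometrically small cost (`exists_geomSmall_sub_gaussian`). Laplace's method then integrates the
-- Taylor polynomial of `s' / s` against the Gaussian: odd moments vanish and even ones give `2^k
-- (1/2)_k / n^k` (`exists_gaussian_expansion`).
--
-- The germ of `s` exists because `ψ - ψ(s₀)` is half an analytic square, and it is unique once
-- `s'(0)` is fixed. Uniqueness together with the symmetry `s(w) = conj (s(-conj w))` makes the even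
-- coefficients of `s' / s` purely imaginary, hence the `A k` real. The explicit `A 1`, `A 2`, `A 3`
-- come from a polynomial differential system for `s'` and `e^s / h - 1`, solved coefficient by
-- coefficient (`coeff_eq_of_saddle_recursion`).
/-- The Taylor series at the origin of a complex function. -/
def taylorSeries (f : ℂ → ℂ) : PowerSeries ℂ :=
  PowerSeries.mk fun m => iteratedDeriv m f 0 / (m.factorial : ℂ)

theorem coeff_taylorSeries (f : ℂ → ℂ) (m : ℕ) :
    PowerSeries.coeff m (taylorSeries f) = iteratedDeriv m f 0 / (m.factorial : ℂ) := by
  simp [taylorSeries]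

theorem constantCoeff_taylorSeries (f : ℂ → ℂ) :
    PowerSeries.constantCoeff (taylorSeries f) = f 0 := by
  rw [← PowerSeries.coeff_zero_eq_constantCoeff_apply, coeff_taylorSeries]; simp

theorem taylorSeries_congr {f g : ℂ → ℂ} (h : f =ᶠ[nhds 0] g) :
    taylorSeries f = taylorSeries g := by
  ext m
  rw [coeff_taylorSeries, coeff_taylorSeries, h.iteratedDeriv_eq]

theorem taylorSeries_add {f g : ℂ → ℂ} (hf : AnalyticAt ℂ f 0) (hg : AnalyticAt ℂ g 0) :
    taylorSeries (fun z => f z + g z) = taylorSeries f + taylorSeries g := by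
  ext m
  rw [map_add, coeff_taylorSeries, coeff_taylorSeries, coeff_taylorSeries,
    iteratedDeriv_fun_add hf.contDiffAt hg.contDiffAt, add_div]

theorem taylorSeries_mul {f g : ℂ → ℂ} (hf : AnalyticAt ℂ f 0) (hg : AnalyticAt ℂ g 0) :
    taylorSeries (fun z => f z * g z) = taylorSeries f * taylorSeries g := by
  ext m
  rw [PowerSeries.coeff_mul, coeff_taylorSeries,
    iteratedDeriv_fun_mul hf.contDiffAt hg.contDiffAt,
    Finset.Nat.sum_antidiagonal_eq_sum_range_succ_mk, Finset.sum_div]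
  refine Finset.sum_congr rfl fun i hi => ?_
  have hi' : i ≤ m := by simpa [Nat.lt_succ_iff] using hi
  rw [coeff_taylorSeries, coeff_taylorSeries, Nat.cast_choose ℂ hi']
  have h1 : (m.factorial : ℂ) ≠ 0 := by exact_mod_cast m.factorial_ne_zero
  field_simp

theorem taylorSeries_pow {f : ℂ → ℂ} (hf : AnalyticAt ℂ f 0) (n : ℕ) :
    taylorSeries (fun z => f z ^ n) = taylorSeries f ^ n := by
  induction n with
  | zero =>
    ext m
    simp only [pow_zero, coeff_taylorSeries, iteratedDeriv_const, PowerSeries.coeff_one]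
    split_ifs with h <;> simp [h]
  | succ n ih =>
    rw [pow_succ, ← ih, ← taylorSeries_mul (hf.fun_pow n) hf]
    rfl

theorem taylorSeries_const (c : ℂ) : taylorSeries (fun _ => c) = PowerSeries.C c := by
  ext m
  simp only [coeff_taylorSeries, iteratedDeriv_const, PowerSeries.coeff_C]
  split_ifs with h <;> simp [h]

theorem taylorSeries_id : taylorSeries (fun z => z) = PowerSeries.X := by
  ext m
  rw [coeff_taylorSeries, PowerSeries.coeff_X, iteratedDeriv_eq_iterate]
  rcases m with _ | _ | m
  · simp
  · simp
  · simp only [Function.iterate_succ, Function.comp, deriv_id'', deriv_const']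
    rw [if_neg (by omega), ← iteratedDeriv_eq_iterate, iteratedDeriv_const]
    simp

theorem coeff_taylorSeries_deriv (f : ℂ → ℂ) (m : ℕ) :
    PowerSeries.coeff m (taylorSeries (deriv f)) =
      (m + 1) * PowerSeries.coeff (m + 1) (taylorSeries f) := by
  rw [coeff_taylorSeries, coeff_taylorSeries, iteratedDeriv_succ', Nat.factorial_succ]
  have h1 : (m.factorial : ℂ) ≠ 0 := by exact_mod_cast m.factorial_ne_zero
  have h2 : (m : ℂ) + 1 ≠ 0 := by exact_mod_cast m.succ_ne_zero
  push_cast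
  field_simp

theorem taylorSeries_cexp (c : ℂ) :
    taylorSeries (fun z => Complex.exp (c * z)) =
      PowerSeries.rescale c (PowerSeries.exp ℂ) := by
  ext m
  rw [coeff_taylorSeries, iteratedDeriv_cexp_const_mul, PowerSeries.coeff_rescale,
    PowerSeries.coeff_exp]
  simp [div_eq_mul_inv]

/-- The entire function `(e^z - 1) / z`. -/
def expQuot : ℂ → ℂ := dslope Complex.exp 0

theorem differentiable_expQuot : Differentiable ℂ expQuot := by
  rw [← differentiableOn_univ]
  exact (Complex.differentiableOn_dslope Filter.univ_mem).2 Complex.differentiable_exp.differentiableOn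

theorem analyticAt_expQuot (z : ℂ) : AnalyticAt ℂ expQuot z := differentiable_expQuot.analyticAt z

theorem mul_expQuot (z : ℂ) : z * expQuot z = Complex.exp z - 1 := by
  simpa [expQuot] using sub_smul_dslope Complex.exp (0 : ℂ) z

theorem expQuot_zero : expQuot 0 = 1 := by
  simp [expQuot, dslope_same]

/-- The zeros of `e^z - 1` are the points `2πik`; the strip leaves only `k = 0`, where the quotient
is `1`. -/
theorem expQuot_ne_zero {z : ℂ} (hz : |z.im| < 2 * Real.pi) : expQuot z ≠ 0 := by
  intro h
  have h1 := mul_expQuot z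
  rw [h, mul_zero] at h1
  obtain ⟨k, hk⟩ := Complex.exp_eq_one_iff.1 (sub_eq_zero.1 h1.symm)
  have him : z.im = k * (2 * Real.pi) := by
    rw [hk]; simp
  have hk0 : k = 0 := by
    rw [him, abs_mul, abs_of_pos (show (0 : ℝ) < 2 * Real.pi by positivity)] at hz
    have : |(k : ℝ)| < 1 := by
      by_contra! hc
      nlinarith [Real.pi_pos]
    exact Int.abs_lt_one_iff.1 (by exact_mod_cast this)
  rw [hk0] at hk
  simp only [Int.cast_zero, zero_mul] at hk
  rw [hk, expQuot_zero] at h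
  exact one_ne_zero h

theorem bernoulliPowerSeries_mul_taylorSeries_expQuot :
    bernoulliPowerSeries ℂ * taylorSeries expQuot = 1 := by
  have h1 : PowerSeries.X * taylorSeries expQuot = PowerSeries.exp ℂ - 1 := by
    rw [← taylorSeries_id, ← taylorSeries_mul (f := fun z => z) analyticAt_id (analyticAt_expQuot 0)]
    have : (fun z => z * expQuot z) = fun z => Complex.exp (1 * z) + -1 := by
      ext z; rw [mul_expQuot]; simp [sub_eq_add_neg]
    rw [this, taylorSeries_add (by fun_prop) (by fun_prop), taylorSeries_cexp, taylorSeries_const]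
    simp [sub_eq_add_neg]
  have h2 := bernoulliPowerSeries_mul_exp_sub_one ℂ
  rw [← h1, mul_left_comm] at h2
  exact mul_left_cancel₀ PowerSeries.X_ne_zero (h2.trans (mul_one _).symm)

/-- The function `(z / (e^z - 1))^n e^{yz}` generating the Bernoulli polynomials of order `n`. -/
def genBernoulliFun (n : ℕ) (y : ℝ) (z : ℂ) : ℂ := (expQuot z)⁻¹ ^ n * Complex.exp (y * z)

/-- Both `1 / expQuot` and the Bernoulli series are inverse to the Taylor series of `expQuot`, so
they coincide. This links the formal definition over `ℝ` to an analytic function on `ℂ`. -/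
theorem taylorSeries_genBernoulliFun (n : ℕ) (y : ℝ) :
    taylorSeries (genBernoulliFun n y) =
      ((bernoulliPowerSeries ℝ) ^ n * PowerSeries.rescale y (PowerSeries.exp ℝ)).map
        (algebraMap ℝ ℂ) := by
  have h0 : AnalyticAt ℂ (fun z => (expQuot z)⁻¹) 0 :=
    (analyticAt_expQuot 0).fun_inv (by rw [expQuot_zero]; exact one_ne_zero)
  have h1 : taylorSeries (fun z => (expQuot z)⁻¹) * taylorSeries expQuot = 1 := by
    rw [← taylorSeries_mul h0 (analyticAt_expQuot 0), ← map_one PowerSeries.C,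
      ← taylorSeries_const]
    refine taylorSeries_congr ?_
    have : ∀ᶠ z in nhds (0 : ℂ), expQuot z ≠ 0 :=
      (analyticAt_expQuot 0).continuousAt.eventually_ne (by rw [expQuot_zero]; exact one_ne_zero)
    filter_upwards [this] with z hz
    exact inv_mul_cancel₀ hz
  have h2 : taylorSeries (fun z => (expQuot z)⁻¹) = bernoulliPowerSeries ℂ := by
    calc _ = taylorSeries (fun z => (expQuot z)⁻¹) *
          (bernoulliPowerSeries ℂ * taylorSeries expQuot) := by
          rw [bernoulliPowerSeries_mul_taylorSeries_expQuot, mul_one]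
      _ = bernoulliPowerSeries ℂ * (taylorSeries (fun z => (expQuot z)⁻¹) * taylorSeries expQuot) := by
          ring
      _ = _ := by rw [h1, mul_one]
  have h3 : (bernoulliPowerSeries ℝ).map (algebraMap ℝ ℂ) = bernoulliPowerSeries ℂ := by
    ext m; simp [bernoulliPowerSeries]
  have h4 : (PowerSeries.rescale y (PowerSeries.exp ℝ)).map (algebraMap ℝ ℂ) =
      PowerSeries.rescale (y : ℂ) (PowerSeries.exp ℂ) := by
    ext m; simp [PowerSeries.coeff_rescale, PowerSeries.coeff_exp]
  unfold genBernoulliFun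
  rw [taylorSeries_mul (h0.fun_pow n) (by fun_prop), taylorSeries_pow h0, taylorSeries_cexp, h2,
    map_mul, map_pow, h3, h4]

theorem genBernoulli_eq_taylorSeries (n : ℕ) (y : ℝ) :
    (genBernoulli n n y : ℂ) =
      n.factorial * PowerSeries.coeff n (taylorSeries (genBernoulliFun n y)) := by
  rw [taylorSeries_genBernoulliFun, PowerSeries.coeff_map, genBernoulli]
  simp
end

/-! ### The residue theorem on a rectangle -/

noncomputable section

open Complex in
/-- The integral of `f` along the boundary of the rectangle `[-p, q] × [-r, r]`. -/
def rectIntegral (p q r : ℝ) (f : ℂ → ℂ) : ℂ :=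
  (∫ x in (-p)..q, f (x + ((-r : ℝ) : ℂ) * I)) - (∫ x in (-p)..q, f (x + (r : ℂ) * I))
    + I * (∫ y in (-r)..r, f ((q : ℂ) + y * I)) - I * ∫ y in (-r)..r, f (((-p : ℝ) : ℂ) + y * I)

/-- The closed rectangle `[-p, q] × [-r, r]` without the origin. -/
def puncturedRect (p q r : ℝ) : Set ℂ :=
  {z | z ≠ 0 ∧ z.re ∈ Set.uIcc (-p) q ∧ z.im ∈ Set.uIcc (-r) r}

open Complex in
theorem integral_horizontal_of_hasDerivAt {f F : ℂ → ℂ} {a b y : ℝ}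
    (hF : ∀ x ∈ Set.uIcc a b, HasDerivAt F (f (x + (y : ℂ) * I)) (x + (y : ℂ) * I))
    (hf : ContinuousOn (fun x : ℝ => f (x + (y : ℂ) * I)) (Set.uIcc a b)) :
    ∫ x in a..b, f (x + (y : ℂ) * I) = F (b + (y : ℂ) * I) - F (a + (y : ℂ) * I) := by
  refine intervalIntegral.integral_eq_sub_of_hasDerivAt
    (f := fun x : ℝ => F (x + (y : ℂ) * I)) (fun x hx => ?_) hf.intervalIntegrable
  have h1 : HasDerivAt (fun x : ℝ => (x : ℂ) + (y : ℂ) * I) 1 x :=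
    (Complex.ofRealCLM.hasDerivAt (x := x)).add_const _
  exact (HasDerivAt.comp x (hF x hx) h1).congr_deriv (mul_one _)

open Complex in
theorem integral_vertical_of_hasDerivAt {f F : ℂ → ℂ} {a b x : ℝ}
    (hF : ∀ y ∈ Set.uIcc a b, HasDerivAt F (f ((x : ℂ) + y * I)) ((x : ℂ) + y * I))
    (hf : ContinuousOn (fun y : ℝ => f ((x : ℂ) + y * I)) (Set.uIcc a b)) :
    I * ∫ y in a..b, f ((x : ℂ) + y * I) = F ((x : ℂ) + b * I) - F ((x : ℂ) + a * I) := by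
  rw [← intervalIntegral.integral_const_mul]
  refine intervalIntegral.integral_eq_sub_of_hasDerivAt
    (f := fun y : ℝ => F ((x : ℂ) + y * I)) (fun y hy => ?_)
    (continuousOn_const.fun_mul hf).intervalIntegrable
  have h1 : HasDerivAt (fun y : ℝ => (x : ℂ) + (y : ℂ) * I) I y := by
    simpa using ((Complex.ofRealCLM.hasDerivAt (x := y)).mul_const I).const_add (x : ℂ)
  exact (HasDerivAt.comp y (hF y hy) h1).congr_deriv (mul_comm _ _)

section
variable {p q r : ℝ}

open Complex in
theorem mem_puncturedRect_bottom (hr : 0 < r) {x : ℝ}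
    (hx : x ∈ Set.uIcc (-p) q) : (x : ℂ) + ((-r : ℝ) : ℂ) * I ∈ puncturedRect p q r := by
  refine ⟨fun h => ?_, by simpa using hx, by simp⟩
  have := congrArg Complex.im h
  simp at this
  exact hr.ne' this

open Complex in
theorem mem_puncturedRect_top (hr : 0 < r) {x : ℝ}
    (hx : x ∈ Set.uIcc (-p) q) : (x : ℂ) + (r : ℂ) * I ∈ puncturedRect p q r := by
  refine ⟨fun h => ?_, by simpa using hx, by simp⟩
  have := congrArg Complex.im h
  simp at this
  exact hr.ne' this

open Complex in
theorem mem_puncturedRect_right (hq : 0 < q) {y : ℝ}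
    (hy : y ∈ Set.uIcc (-r) r) : (q : ℂ) + y * I ∈ puncturedRect p q r := by
  refine ⟨fun h => ?_, by simp, by simpa using hy⟩
  have := congrArg Complex.re h
  simp at this
  exact hq.ne' this

open Complex in
theorem mem_puncturedRect_left (hp : 0 < p) {y : ℝ}
    (hy : y ∈ Set.uIcc (-r) r) : ((-p : ℝ) : ℂ) + y * I ∈ puncturedRect p q r := by
  refine ⟨fun h => ?_, by simp, by simpa using hy⟩
  have := congrArg Complex.re h
  simp at this
  exact hp.ne' this

open Complex in
theorem continuousOn_bottom (hr : 0 < r) {f : ℂ → ℂ} (hf : ContinuousOn f (puncturedRect p q r)) :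
    ContinuousOn (fun x : ℝ => f (x + ((-r : ℝ) : ℂ) * I)) (Set.uIcc (-p) q) :=
  hf.comp (by fun_prop) fun _ hx => mem_puncturedRect_bottom hr hx

open Complex in
theorem continuousOn_top (hr : 0 < r) {f : ℂ → ℂ} (hf : ContinuousOn f (puncturedRect p q r)) :
    ContinuousOn (fun x : ℝ => f (x + (r : ℂ) * I)) (Set.uIcc (-p) q) :=
  hf.comp (by fun_prop) fun _ hx => mem_puncturedRect_top hr hx

open Complex in
theorem continuousOn_right (hq : 0 < q) {f : ℂ → ℂ} (hf : ContinuousOn f (puncturedRect p q r)) :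
    ContinuousOn (fun y : ℝ => f ((q : ℂ) + y * I)) (Set.uIcc (-r) r) :=
  hf.comp (by fun_prop) fun _ hx => mem_puncturedRect_right hq hx

open Complex in
theorem continuousOn_left (hp : 0 < p) {f : ℂ → ℂ} (hf : ContinuousOn f (puncturedRect p q r)) :
    ContinuousOn (fun y : ℝ => f (((-p : ℝ) : ℂ) + y * I)) (Set.uIcc (-r) r) :=
  hf.comp (by fun_prop) fun _ hx => mem_puncturedRect_left hp hx

theorem rectIntegral_congr (hp : 0 < p) (hq : 0 < q) (hr : 0 < r) {f g : ℂ → ℂ}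
    (h : Set.EqOn f g (puncturedRect p q r)) :
    rectIntegral p q r f = rectIntegral p q r g := by
  unfold rectIntegral
  congr 1
  · congr 1
    · congr 1
      · exact intervalIntegral.integral_congr fun x hx => h (mem_puncturedRect_bottom hr hx)
      · exact intervalIntegral.integral_congr fun x hx => h (mem_puncturedRect_top hr hx)
    · congr 1
      exact intervalIntegral.integral_congr fun x hx => h (mem_puncturedRect_right hq hx)
  · congr 1
    exact intervalIntegral.integral_congr fun x hx => h (mem_puncturedRect_left hp hx)

theorem rectIntegral_add (hp : 0 < p) (hq : 0 < q) (hr : 0 < r) {f g : ℂ → ℂ}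
    (hf : ContinuousOn f (puncturedRect p q r)) (hg : ContinuousOn g (puncturedRect p q r)) :
    rectIntegral p q r (fun z => f z + g z) = rectIntegral p q r f + rectIntegral p q r g := by
  unfold rectIntegral
  rw [intervalIntegral.integral_add (continuousOn_bottom hr hf).intervalIntegrable
      (continuousOn_bottom hr hg).intervalIntegrable,
    intervalIntegral.integral_add (continuousOn_top hr hf).intervalIntegrable
      (continuousOn_top hr hg).intervalIntegrable,
    intervalIntegral.integral_add (continuousOn_right hq hf).intervalIntegrable
      (continuousOn_right hq hg).intervalIntegrable,
    intervalIntegral.integral_add (continuousOn_left hp hf).intervalIntegrable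
      (continuousOn_left hp hg).intervalIntegrable]
  ring

theorem rectIntegral_const_mul (c : ℂ) (f : ℂ → ℂ) :
    rectIntegral p q r (fun z => c * f z) = c * rectIntegral p q r f := by
  unfold rectIntegral
  simp only [intervalIntegral.integral_const_mul]
  ring

theorem rectIntegral_eq_zero_of_hasDerivAt (hp : 0 < p) (hq : 0 < q) (hr : 0 < r) {f F : ℂ → ℂ}
    (hf : ContinuousOn f (puncturedRect p q r))
    (hF : ∀ z ∈ puncturedRect p q r, HasDerivAt F (f z) z) : rectIntegral p q r f = 0 := by
  unfold rectIntegral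
  rw [integral_horizontal_of_hasDerivAt (fun x hx => hF _ (mem_puncturedRect_bottom hr hx))
      (continuousOn_bottom hr hf),
    integral_horizontal_of_hasDerivAt (fun x hx => hF _ (mem_puncturedRect_top hr hx))
      (continuousOn_top hr hf),
    integral_vertical_of_hasDerivAt (fun x hx => hF _ (mem_puncturedRect_right hq hx))
      (continuousOn_right hq hf),
    integral_vertical_of_hasDerivAt (fun x hx => hF _ (mem_puncturedRect_left hp hx))
      (continuousOn_left hp hf)]
  ring

theorem continuousOn_inv_pow (n : ℕ) :
    ContinuousOn (fun z : ℂ => (z ^ n)⁻¹) (puncturedRect p q r) :=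
  (continuous_pow n).continuousOn.inv₀ fun _ hz => pow_ne_zero n hz.1

theorem rectIntegral_inv_pow (hp : 0 < p) (hq : 0 < q) (hr : 0 < r) (n : ℕ) :
    rectIntegral p q r (fun z => (z ^ (n + 2))⁻¹) = 0 := by
  refine rectIntegral_eq_zero_of_hasDerivAt hp hq hr (continuousOn_inv_pow _)
    (F := fun z => (-((n : ℂ) + 1)⁻¹) * (z ^ (n + 1))⁻¹) fun z hz => ?_
  have h1 := ((hasDerivAt_pow (n + 1) z).fun_inv (pow_ne_zero _ hz.1)).const_mul
    (-((n : ℂ) + 1)⁻¹)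
  refine h1.congr_deriv ?_
  have h2 : (n : ℂ) + 1 ≠ 0 := by exact_mod_cast n.succ_ne_zero
  have h3 := hz.1
  push_cast
  field_simp
  ring_nf

-- The principal logarithm is a primitive on the bottom, right and top sides. The left side crosses
-- its cut, so `log (-z)` serves there, and each of the two left corners contributes a mismatch of
-- `πi`.
open Complex in
theorem rectIntegral_inv (hp : 0 < p) (hq : 0 < q) (hr : 0 < r) :
    rectIntegral p q r (fun z => z⁻¹) = 2 * Real.pi * I := by
  have hc : ContinuousOn (fun z : ℂ => z⁻¹) (puncturedRect p q r) := by
    simpa using continuousOn_inv_pow (p := p) (q := q) (r := r) 1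
  have hlog : ∀ z : ℂ, 0 < z.re ∨ z.im ≠ 0 → HasDerivAt Complex.log z⁻¹ z :=
    fun z hz => Complex.hasDerivAt_log hz
  have hlog' : ∀ z : ℂ, z.re < 0 → HasDerivAt (fun z => Complex.log (-z)) z⁻¹ z := by
    intro z hz
    have h1 : -z ∈ Complex.slitPlane := Or.inl (by simpa using hz)
    have h2 := (hasDerivAt_neg z).clog h1
    exact h2.congr_deriv (by rw [neg_div_neg_eq, one_div])
  unfold rectIntegral
  rw [integral_horizontal_of_hasDerivAt (f := fun z => z⁻¹) (F := Complex.log)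
      (fun x hx => hlog _ (Or.inr (by simpa using hr.ne'))) (continuousOn_bottom hr hc),
    integral_horizontal_of_hasDerivAt (f := fun z => z⁻¹) (F := Complex.log)
      (fun x hx => hlog _ (Or.inr (by simpa using hr.ne'))) (continuousOn_top hr hc),
    integral_vertical_of_hasDerivAt (f := fun z => z⁻¹) (F := Complex.log)
      (fun x hx => hlog _ (Or.inl (by simpa using hq))) (continuousOn_right hq hc),
    integral_vertical_of_hasDerivAt (f := fun z => z⁻¹) (F := fun z => Complex.log (-z))
      (fun x hx => hlog' _ (by simpa using hp)) (continuousOn_left hp hc)]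
  have e1 : Complex.log (((-p : ℝ) : ℂ) + (r : ℂ) * I) =
      Complex.log (-(((-p : ℝ) : ℂ) + (r : ℂ) * I)) + Real.pi * I := by
    rw [Complex.log, Complex.log, norm_neg,
      Complex.arg_neg_eq_arg_sub_pi_of_im_pos (by simpa using hr)]
    push_cast; ring
  have e2 : Complex.log (((-p : ℝ) : ℂ) + ((-r : ℝ) : ℂ) * I) =
      Complex.log (-(((-p : ℝ) : ℂ) + ((-r : ℝ) : ℂ) * I)) - Real.pi * I := by
    rw [Complex.log, Complex.log, norm_neg,
      Complex.arg_neg_eq_arg_add_pi_of_im_neg (by simpa using hr)]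
    push_cast; ring
  rw [e1, e2]
  ring

/-- The residue theorem on a rectangle for a pole at the origin. -/
theorem rectIntegral_div_pow (hp : 0 < p) (hq : 0 < q) (hr : 0 < r) (n : ℕ) {f : ℂ → ℂ}
    (hf : DifferentiableOn ℂ f (Set.uIcc (-p) q ×ℂ Set.uIcc (-r) r)) :
    rectIntegral p q r (fun z => f z / z ^ (n + 1)) =
      2 * Real.pi * Complex.I * PowerSeries.coeff n (taylorSeries f) := by
  have hnhds : Set.uIcc (-p) q ×ℂ Set.uIcc (-r) r ∈ nhds (0 : ℂ) := by
    refine Filter.inter_mem (Complex.continuous_re.continuousAt.preimage_mem_nhds ?_)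
      (Complex.continuous_im.continuousAt.preimage_mem_nhds ?_)
    · rw [Set.uIcc_of_le (by linarith)]; exact Icc_mem_nhds (by simpa) (by simpa)
    · rw [Set.uIcc_of_le (by linarith)]; exact Icc_mem_nhds (by simpa) (by simpa)
  have hsub : puncturedRect p q r ⊆ Set.uIcc (-p) q ×ℂ Set.uIcc (-r) r :=
    fun z hz => ⟨hz.2.1, hz.2.2⟩
  induction n generalizing f with
  | zero =>
    have hd := (Complex.differentiableOn_dslope hnhds).2 hf
    have hz : rectIntegral p q r (dslope f 0) = 0 := by
      have := Complex.integral_boundary_rect_eq_zero_of_differentiableOn (dslope f 0)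
        ⟨-p, -r⟩ ⟨q, r⟩ hd
      simpa [rectIntegral] using this
    have h1 : rectIntegral p q r (fun z => f z / z ^ (0 + 1)) =
        rectIntegral p q r (fun z => f 0 * z⁻¹ + dslope f 0 z) := by
      refine rectIntegral_congr hp hq hr fun z hz => ?_
      have h2 := sub_smul_dslope f (0 : ℂ) z
      simp only [sub_zero, smul_eq_mul] at h2
      have h3 := hz.1
      simp only [zero_add, pow_one]
      rw [eq_comm, sub_eq_iff_eq_add] at h2
      rw [h2]; field_simp; ring
    rw [h1, rectIntegral_add hp hq hr
      (continuousOn_const.fun_mul (by simpa using continuousOn_inv_pow (p := p) (q := q) (r := r) 1))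
      (hd.continuousOn.mono hsub), rectIntegral_const_mul, rectIntegral_inv hp hq hr, hz,
      PowerSeries.coeff_zero_eq_constantCoeff_apply, constantCoeff_taylorSeries]
    ring
  | succ n ih =>
    have hd := (Complex.differentiableOn_dslope hnhds).2 hf
    have hfd : ∀ z, f z = f 0 + z * dslope f 0 z := fun z => by
      have h2 := sub_smul_dslope f (0 : ℂ) z
      simp only [sub_zero, smul_eq_mul] at h2
      rw [h2]; ring
    have h1 : rectIntegral p q r (fun z => f z / z ^ (n + 1 + 1)) =
        rectIntegral p q r (fun z => f 0 * (z ^ (n + 2))⁻¹ + dslope f 0 z / z ^ (n + 1)) := by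
      refine rectIntegral_congr hp hq hr fun z hz => ?_
      have h3 := hz.1
      rw [hfd z]; field_simp; ring
    have h4 : PowerSeries.coeff (n + 1) (taylorSeries f) =
        PowerSeries.coeff n (taylorSeries (dslope f 0)) := by
      have hda : AnalyticAt ℂ (dslope f 0) 0 := hd.analyticAt hnhds
      have : taylorSeries f = PowerSeries.C (f 0) +
          PowerSeries.X * taylorSeries (dslope f 0) := by
        rw [← taylorSeries_const, ← taylorSeries_id,
          ← taylorSeries_mul (f := fun z => z) analyticAt_id hda,
          ← taylorSeries_add (g := fun z => z * dslope f 0 z) analyticAt_const (analyticAt_id.fun_mul hda)]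
        exact congrArg _ (funext hfd)
      rw [this, map_add, PowerSeries.coeff_succ_X_mul, PowerSeries.coeff_C]
      simp
    have h5 : ContinuousOn (fun z => dslope f 0 z / z ^ (n + 1)) (puncturedRect p q r) :=
      (hd.continuousOn.mono hsub).div (continuous_pow _).continuousOn
        fun _ hz => pow_ne_zero _ hz.1
    rw [h1, rectIntegral_add hp hq hr (continuousOn_const.fun_mul (continuousOn_inv_pow _)) h5,
      rectIntegral_const_mul, rectIntegral_inv_pow hp hq hr,
      ih hd, h4]
    ring

end
end

/-! ### Geometrically small errors and the modulus of the integrand on the contour -/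

noncomputable section

/-- The sequence `u` decays at least geometrically. -/
def GeomSmall (u : ℕ → ℂ) : Prop := ∃ q C : ℝ, 0 ≤ q ∧ q < 1 ∧ 0 ≤ C ∧ ∀ n, ‖u n‖ ≤ C * q ^ n

theorem GeomSmall.add {u v : ℕ → ℂ} (hu : GeomSmall u) (hv : GeomSmall v) :
    GeomSmall (fun n => u n + v n) := by
  obtain ⟨q, C, hq0, hq1, hC, h⟩ := hu
  obtain ⟨q', C', hq0', hq1', hC', h'⟩ := hv
  refine ⟨max q q', C + C', le_max_of_le_left hq0, max_lt hq1 hq1', by positivity, fun n => ?_⟩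
  have h1 : q ^ n ≤ max q q' ^ n := pow_le_pow_left₀ hq0 (le_max_left _ _) n
  have h2 : q' ^ n ≤ max q q' ^ n := pow_le_pow_left₀ hq0' (le_max_right _ _) n
  calc ‖u n + v n‖ ≤ ‖u n‖ + ‖v n‖ := norm_add_le _ _
    _ ≤ C * q ^ n + C' * q' ^ n := add_le_add (h n) (h' n)
    _ ≤ C * max q q' ^ n + C' * max q q' ^ n := by gcongr
    _ = _ := by ring

theorem GeomSmall.const_mul {u : ℕ → ℂ} (hu : GeomSmall u) (c : ℂ) :
    GeomSmall (fun n => c * u n) := by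
  obtain ⟨q, C, hq0, hq1, hC, h⟩ := hu
  refine ⟨q, ‖c‖ * C, hq0, hq1, by positivity, fun n => ?_⟩
  rw [norm_mul, mul_assoc]
  exact mul_le_mul_of_nonneg_left (h n) (norm_nonneg c)

theorem GeomSmall.sub {u v : ℕ → ℂ} (hu : GeomSmall u) (hv : GeomSmall v) :
    GeomSmall (fun n => u n - v n) := by
  simpa [sub_eq_add_neg] using hu.add (hv.const_mul (-1))

/-- A geometric sequence beats every power of `n`, so such errors are invisible at every order of
the expansion. -/
theorem GeomSmall.isBigO {u : ℕ → ℂ} (hu : GeomSmall u) (a : ℝ) :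
    u =O[Filter.atTop] fun n : ℕ => (n : ℝ) ^ a := by
  obtain ⟨q, C, hq0, hq1, hC, h⟩ := hu
  have h1 : u =O[Filter.atTop] fun n : ℕ => q ^ n :=
    Asymptotics.IsBigO.of_bound C (Filter.Eventually.of_forall fun n => by
      rw [Real.norm_of_nonneg (by positivity)]; exact h n)
  obtain ⟨k, hk⟩ := exists_nat_ge (-a)
  have h2 := tendsto_pow_const_mul_const_pow_of_lt_one k hq0 hq1
  have h3 : (fun n : ℕ => q ^ n) =O[Filter.atTop] fun n : ℕ => (n : ℝ) ^ a := by
    have h4 : (fun n : ℕ => (n : ℝ) ^ k * q ^ n) =O[Filter.atTop] fun _ => (1 : ℝ) :=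
      h2.isBigO_one ℝ
    obtain ⟨D, hD⟩ := h4.bound
    refine Asymptotics.IsBigO.of_bound D ?_
    filter_upwards [hD, Filter.eventually_ge_atTop 1] with n hn hn1
    have hn1' : (1 : ℝ) ≤ n := by exact_mod_cast hn1
    have hn0 : (0 : ℝ) < n := by linarith
    rw [norm_one, mul_one, Real.norm_of_nonneg (by positivity)] at hn
    rw [Real.norm_of_nonneg (by positivity), Real.norm_of_nonneg (by positivity)]
    have h5 : (n : ℝ) ^ (-a) ≤ (n : ℝ) ^ k := by
      rw [← Real.rpow_natCast]; exact Real.rpow_le_rpow_of_exponent_le hn1' hk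
    have h6 : (n : ℝ) ^ (-a) * q ^ n ≤ D :=
      (mul_le_mul_of_nonneg_right h5 (by positivity)).trans hn
    rw [Real.rpow_neg hn0.le, inv_mul_le_iff₀ (by positivity)] at h6
    linarith
  exact h1.trans h3

theorem exists_norm_le_lt_one {f : ℝ → ℂ} {a b : ℝ} (hf : ContinuousOn f (Set.uIcc a b))
    (h1 : ∀ x ∈ Set.uIcc a b, ‖f x‖ < 1) :
    ∃ q : ℝ, 0 ≤ q ∧ q < 1 ∧ ∀ x ∈ Set.uIcc a b, ‖f x‖ ≤ q := by
  obtain ⟨y, hy, hmax⟩ := isCompact_uIcc.exists_isMaxOn Set.nonempty_uIcc hf.norm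
  exact ⟨‖f y‖, norm_nonneg _, h1 y hy, fun x hx => hmax hx⟩

/-- Compactness upgrades the pointwise strict bound on `f` to a uniform ratio below `1`. -/
theorem geomSmall_integral {f k : ℝ → ℂ} {a b : ℝ} (hf : ContinuousOn f (Set.uIcc a b))
    (hk : ContinuousOn k (Set.uIcc a b)) (h1 : ∀ x ∈ Set.uIcc a b, ‖f x‖ < 1) :
    GeomSmall (fun n => ∫ x in a..b, f x ^ n * k x) := by
  obtain ⟨q, hq0, hq1, hq⟩ := exists_norm_le_lt_one hf h1
  obtain ⟨D, hD⟩ := isCompact_uIcc.exists_bound_of_continuousOn hk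
  have hD0 : 0 ≤ D := (norm_nonneg _).trans (hD a Set.left_mem_uIcc)
  refine ⟨q, D * |b - a|, hq0, hq1, by positivity, fun n => ?_⟩
  have : ∀ x ∈ Set.uIoc a b, ‖f x ^ n * k x‖ ≤ q ^ n * D := fun x hx => by
    have hx' := Set.uIoc_subset_uIcc hx
    rw [norm_mul, norm_pow]
    exact mul_le_mul (pow_le_pow_left₀ (norm_nonneg _) (hq x hx') n) (hD x hx') (norm_nonneg _)
      (by positivity)
  refine (intervalIntegral.norm_integral_le_of_norm_le_const this).trans (le_of_eq (by ring))

theorem one_lt_hPar {x : ℝ} (hx : 1 < x) : 1 < hPar x := by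
  rw [hPar, lt_div_iff₀ (by linarith)]; linarith

theorem saddlePt_pos {x : ℝ} (hx : 1 < x) : 0 < saddlePt x := Real.log_pos (one_lt_hPar hx)

theorem exp_saddlePt {x : ℝ} (hx : 1 < x) : Real.exp (saddlePt x) = hPar x :=
  Real.exp_log (by linarith [one_lt_hPar hx])

/-- The function `exp (ψ(s₀) - ψ(t))`, where `ψ` is the phase. -/
def saddleRatio (x : ℝ) (t : ℂ) : ℂ :=
  (((hPar x - 1) / hPar x ^ x : ℝ) : ℂ) * (Complex.exp (x * t) / (Complex.exp t - 1))

theorem norm_saddleRatio {x : ℝ} (hx : 1 < x) (t : ℂ) :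
    ‖saddleRatio x t‖ =
      (hPar x - 1) / hPar x ^ x * (Real.exp t.re ^ x / ‖Complex.exp t - 1‖) := by
  have h1 := one_lt_hPar hx
  have h2 : 0 ≤ (hPar x - 1) / hPar x ^ x :=
    div_nonneg (by linarith) (Real.rpow_nonneg (by linarith) _)
  rw [saddleRatio, norm_mul, norm_div, Complex.norm_real, Real.norm_of_nonneg h2,
    Complex.norm_exp, ← Real.exp_mul]
  congr 4
  simp [mul_comm]

theorem norm_saddleRatio_lt_one {x : ℝ} (hx : 1 < x) {t : ℂ}
    (h : Real.exp t.re ^ x * (hPar x - 1) < hPar x ^ x * ‖Complex.exp t - 1‖) :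
    ‖saddleRatio x t‖ < 1 := by
  have h1 := one_lt_hPar hx
  have h2 : 0 < hPar x ^ x := Real.rpow_pos_of_pos (by linarith) _
  have h3 : 0 < Real.exp t.re ^ x * (hPar x - 1) :=
    mul_pos (Real.rpow_pos_of_pos (Real.exp_pos _) _) (by linarith)
  have h4 : 0 < ‖Complex.exp t - 1‖ := pos_of_mul_pos_right (h3.trans h) h2.le
  rw [norm_saddleRatio hx, div_mul_div_comm, div_lt_one (by positivity)]
  linarith

/-- Here `u = e^σ / h` lies in `(0, 1]`, so `u^x ≤ u`; the step from `h` to `h - 1` makes the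
inequality strict. Left of the saddle line it therefore suffices to show `|e^t - 1| ≥ e^σ`. -/
theorem exp_rpow_mul_le {x : ℝ} (hx : 1 < x) {σ : ℝ} (hσ : σ ≤ saddlePt x) :
    Real.exp σ ^ x * (hPar x - 1) < hPar x ^ x * Real.exp σ := by
  have h1 := one_lt_hPar hx
  have h0 : 0 < hPar x := by linarith
  have hu : Real.exp σ / hPar x ≤ 1 := by
    rw [div_le_one h0, ← exp_saddlePt hx]; exact Real.exp_le_exp.2 hσ
  have hp : 0 < Real.exp σ / hPar x := by positivity
  have h2 : (Real.exp σ / hPar x) ^ x ≤ Real.exp σ / hPar x :=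
    (Real.rpow_le_rpow_of_exponent_ge hp hu hx.le).trans (by rw [Real.rpow_one])
  rw [Real.div_rpow (Real.exp_pos _).le h0.le,
    div_le_div_iff₀ (Real.rpow_pos_of_pos h0 _) h0] at h2
  have h3 : 0 < Real.exp σ ^ x := Real.rpow_pos_of_pos (Real.exp_pos _) _
  linarith

theorem norm_saddleRatio_lt_one_horizontal {x : ℝ} (hx : 1 < x) {t : ℂ} (ht : t.re ≤ saddlePt x)
    (hcos : Real.cos t.im = -1) : ‖saddleRatio x t‖ < 1 := by
  refine norm_saddleRatio_lt_one hx ((exp_rpow_mul_le hx ht).trans_le ?_)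
  have h0 : 0 < hPar x ^ x := Real.rpow_pos_of_pos (by linarith [one_lt_hPar hx]) _
  refine mul_le_mul_of_nonneg_left ?_ h0.le
  have : (Complex.exp t - 1).re = -Real.exp t.re - 1 := by
    simp [Complex.exp_re, hcos]
  have h2 := Complex.abs_re_le_norm (Complex.exp t - 1)
  rw [this, abs_of_neg (by linarith [Real.exp_pos t.re])] at h2
  linarith

theorem norm_saddleRatio_lt_one_left {x : ℝ} (hx : 1 < x) {t : ℂ} (ht : t.re = -1) :
    ‖saddleRatio x t‖ < 1 := by
  have hs := saddlePt_pos hx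
  refine norm_saddleRatio_lt_one hx ((exp_rpow_mul_le hx (by linarith)).trans_le ?_)
  have h0 : 0 < hPar x ^ x := Real.rpow_pos_of_pos (by linarith [one_lt_hPar hx]) _
  refine mul_le_mul_of_nonneg_left ?_ h0.le
  have h1 : ‖Complex.exp t‖ = Real.exp (-1) := by rw [Complex.norm_exp, ht]
  have h2 := norm_sub_norm_le (1 : ℂ) (Complex.exp t)
  rw [norm_one, h1, norm_sub_rev] at h2
  -- The abscissa `-1` works because `1 - e⁻¹ > e⁻¹`, that is, `e⁻¹ < 1 / 2`.
  have h3 : Real.exp (-1) < 0.3678794412 := Real.exp_neg_one_lt_d9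
  rw [ht]
  norm_num at h3
  linarith

/-- On the line through the saddle the numerator has constant modulus, and `|e^t - 1|` exceeds its
minimum `h - 1` off the multiples of `2πi`. -/
theorem norm_saddleRatio_lt_one_vertical {x : ℝ} (hx : 1 < x) {t : ℂ} (ht : t.re = saddlePt x)
    (hcos : Real.cos t.im < 1) : ‖saddleRatio x t‖ < 1 := by
  have h1 := one_lt_hPar hx
  refine norm_saddleRatio_lt_one hx ?_
  have h0 : 0 < hPar x ^ x := Real.rpow_pos_of_pos (by linarith) _
  rw [ht, exp_saddlePt hx]
  refine mul_lt_mul_of_pos_left ?_ h0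
  have h2 : ‖Complex.exp t - 1‖ ^ 2 = hPar x ^ 2 - 2 * hPar x * Real.cos t.im + 1 := by
    rw [Complex.sq_norm, Complex.normSq_apply]
    simp only [Complex.sub_re, Complex.sub_im, Complex.exp_re, Complex.exp_im, Complex.one_re,
      Complex.one_im, ht, exp_saddlePt hx]
    linear_combination (hPar x) ^ 2 * Real.sin_sq_add_cos_sq t.im
  refine lt_of_pow_lt_pow_left₀ 2 (norm_nonneg _) ?_
  rw [h2]
  nlinarith

theorem exp_sub_one_ne_zero {t : ℂ} (h0 : t ≠ 0) (ht : |t.im| < 2 * Real.pi) :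
    Complex.exp t - 1 ≠ 0 := by
  rw [← mul_expQuot]; exact mul_ne_zero h0 (expQuot_ne_zero ht)

theorem continuousOn_saddleRatio (x : ℝ) {p q r : ℝ} (hr : |r| < 2 * Real.pi) :
    ContinuousOn (saddleRatio x) (puncturedRect p q r) := by
  have h : ∀ t ∈ puncturedRect p q r, Complex.exp t - 1 ≠ 0 := fun t ht => by
    refine exp_sub_one_ne_zero ht.1 (lt_of_le_of_lt ?_ hr)
    have h2 := ht.2.2
    rw [Set.mem_uIcc] at h2
    rw [abs_le]
    rcases h2 with h2 | h2
    · exact ⟨by linarith [le_abs_self r], by linarith [le_abs_self r]⟩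
    · exact ⟨by linarith [neg_abs_le r], by linarith [neg_abs_le r]⟩
  unfold saddleRatio
  fun_prop (disch := assumption)

/-- The part of the contour integral along `[s₀ - iε, s₀ + iε]`. -/
def saddleIntegral (x ε : ℝ) (n : ℕ) : ℂ :=
  Complex.I * ∫ y in (-ε)..ε, saddleRatio x ((saddlePt x : ℂ) + y * Complex.I) ^ n *
    ((saddlePt x : ℂ) + y * Complex.I)⁻¹

/-- Order and degree are both `n`, so `z^n` cancels against the pole `z^(n + 1)`. What remains is a
pure `n`th power times `1 / z`, which is the form needed for the saddle-point method. -/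
theorem rectIntegral_saddleRatio {x : ℝ} (hx : 1 < x) (n : ℕ) :
    rectIntegral 1 (saddlePt x) Real.pi (fun t => saddleRatio x t ^ n * t⁻¹) =
      ((((hPar x - 1) / hPar x ^ x) ^ n : ℝ) : ℂ) * (2 * Real.pi * Complex.I *
        PowerSeries.coeff n (taylorSeries (genBernoulliFun n (n * x)))) := by
  have hq : ∀ t ∈ Set.uIcc (-1) (saddlePt x) ×ℂ Set.uIcc (-Real.pi) Real.pi, expQuot t ≠ 0 := by
    intro t ht
    refine expQuot_ne_zero ?_
    have h2 : t.im ∈ Set.uIcc (-Real.pi) Real.pi := ht.2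
    rw [Set.uIcc_of_le (by linarith [Real.pi_pos])] at h2
    have := abs_le.2 h2
    linarith [Real.pi_pos]
  rw [← rectIntegral_div_pow one_pos (saddlePt_pos hx) Real.pi_pos,
    ← rectIntegral_const_mul]
  · refine rectIntegral_congr one_pos (saddlePt_pos hx) Real.pi_pos fun t ht => ?_
    have h0 := ht.1
    have h1 : expQuot t ≠ 0 := hq t ⟨ht.2.1, ht.2.2⟩
    have h2 : Complex.exp (((n * x : ℝ) : ℂ) * t) = Complex.exp (x * t) ^ n := by
      rw [← Complex.exp_nat_mul]; congr 1; push_cast; ring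
    simp only [saddleRatio, genBernoulliFun]
    rw [h2, ← mul_expQuot]
    push_cast
    simp only [div_pow, mul_pow, inv_pow, pow_succ]
    field_simp
  · unfold genBernoulliFun
    refine DifferentiableOn.mul ((DifferentiableOn.fun_inv
      differentiable_expQuot.differentiableOn hq).fun_pow n) (by fun_prop)

/-- The difference consists of five pieces of the boundary: bottom, top, left, and the two ends of
the right side. None contains the saddle, so `saddleRatio` has modulus below `1` on each. -/
theorem geomSmall_sub_saddleIntegral {x : ℝ} (hx : 1 < x) {ε : ℝ} (h0 : 0 < ε)
    (hε : ε < Real.pi) :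
    GeomSmall fun n => ((((hPar x - 1) / hPar x ^ x) ^ n : ℝ) : ℂ) * (2 * Real.pi * Complex.I *
        PowerSeries.coeff n (taylorSeries (genBernoulliFun n (n * x)))) -
      saddleIntegral x ε n := by
  have hpi := Real.pi_pos
  have hs := saddlePt_pos hx
  have hcr : ContinuousOn (saddleRatio x) (puncturedRect 1 (saddlePt x) Real.pi) :=
    continuousOn_saddleRatio x (by rw [abs_of_pos hpi]; linarith)
  have hci : ContinuousOn (fun t : ℂ => t⁻¹) (puncturedRect 1 (saddlePt x) Real.pi) := by
    simpa using continuousOn_inv_pow (p := 1) (q := saddlePt x) (r := Real.pi) 1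
  have hbot := geomSmall_integral (continuousOn_bottom hpi hcr) (continuousOn_bottom hpi hci)
    fun y hy => norm_saddleRatio_lt_one_horizontal hx
      (by rw [Set.uIcc_of_le (by linarith)] at hy; simpa using hy.2) (by simp)
  have htop := geomSmall_integral (continuousOn_top hpi hcr) (continuousOn_top hpi hci)
    fun y hy => norm_saddleRatio_lt_one_horizontal hx
      (by rw [Set.uIcc_of_le (by linarith)] at hy; simpa using hy.2) (by simp)
  have hleft := geomSmall_integral (continuousOn_left one_pos hcr) (continuousOn_left one_pos hci)
    fun y hy => norm_saddleRatio_lt_one_left hx (by simp)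
  have hR := continuousOn_right (p := 1) hs hcr
  have hRi := continuousOn_right (p := 1) hs hci
  have hcos : ∀ y : ℝ, ε ≤ |y| → |y| ≤ Real.pi → Real.cos y < 1 := fun y h1 h2 => by
    rw [← Real.cos_abs, ← Real.cos_zero]
    exact Real.cos_lt_cos_of_nonneg_of_le_pi le_rfl h2 (by linarith)
  have hsub1 : Set.uIcc (-Real.pi) (-ε) ⊆ Set.uIcc (-Real.pi) Real.pi := by
    rw [Set.uIcc_of_le (by linarith), Set.uIcc_of_le (by linarith)]
    exact Set.Icc_subset_Icc le_rfl (by linarith)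
  have hsub2 : Set.uIcc ε Real.pi ⊆ Set.uIcc (-Real.pi) Real.pi := by
    rw [Set.uIcc_of_le (by linarith), Set.uIcc_of_le (by linarith)]
    exact Set.Icc_subset_Icc (by linarith) le_rfl
  have hsub3 : Set.uIcc (-ε) ε ⊆ Set.uIcc (-Real.pi) Real.pi := by
    rw [Set.uIcc_of_le (by linarith), Set.uIcc_of_le (by linarith)]
    exact Set.Icc_subset_Icc (by linarith) (by linarith)
  have hlow := geomSmall_integral (hR.mono hsub1) (hRi.mono hsub1)
    fun y hy => norm_saddleRatio_lt_one_vertical hx (by simp) (by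
      rw [Set.uIcc_of_le (by linarith)] at hy
      have : |y| = -y := abs_of_nonpos (by linarith [hy.2])
      simpa using hcos y (by linarith [hy.2]) (by linarith [hy.1]))
  have hupp := geomSmall_integral (hR.mono hsub2) (hRi.mono hsub2)
    fun y hy => norm_saddleRatio_lt_one_vertical hx (by simp) (by
      rw [Set.uIcc_of_le (by linarith)] at hy
      have : |y| = y := abs_of_nonneg (by linarith [hy.1])
      simpa using hcos y (by linarith [hy.1]) (by linarith [hy.2]))
  have key := ((hbot.sub htop).add ((hlow.add hupp).const_mul Complex.I)).sub
    (hleft.const_mul Complex.I)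
  convert key using 2 with n
  have hint := (hR.fun_pow n).fun_mul hRi
  rw [← rectIntegral_saddleRatio hx, rectIntegral, saddleIntegral,
    ← intervalIntegral.integral_add_adjacent_intervals (b := -ε) (a := -Real.pi) (c := Real.pi)
      (hint.mono hsub1).intervalIntegrable
      (hint.mono (by
        rw [Set.uIcc_of_le (by linarith), Set.uIcc_of_le (by linarith)]
        exact Set.Icc_subset_Icc (by linarith) le_rfl)).intervalIntegrable,
    ← intervalIntegral.integral_add_adjacent_intervals (b := ε) (a := -ε) (c := Real.pi)
      (hint.mono hsub3).intervalIntegrable (hint.mono hsub2).intervalIntegrable]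
  ring

end

/-! ### The saddle coordinate: existence, uniqueness and symmetry -/

noncomputable section

open Filter Topology

theorem analyticAt_dslope {f : ℂ → ℂ} {z₀ : ℂ} (hf : AnalyticAt ℂ f z₀) :
    AnalyticAt ℂ (dslope f z₀) z₀ := by
  obtain ⟨p, hp⟩ := hf
  exact ⟨_, hp.has_fpower_series_dslope_fslope⟩

/-- An analytic function with a double zero is locally half the square of an analytic function. -/
theorem exists_analyticAt_sq_div_two {f : ℂ → ℂ} {z₀ c : ℂ} (hf : AnalyticAt ℂ f z₀)
    (h0 : f z₀ = 0) (h1 : deriv f z₀ = 0) (h2 : deriv (deriv f) z₀ = c ^ 2) (hc : c ≠ 0) :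
    ∃ W : ℂ → ℂ, AnalyticAt ℂ W z₀ ∧ W z₀ = 0 ∧ deriv W z₀ = c ∧
      ∀ᶠ z in 𝓝 z₀, f z = W z ^ 2 / 2 := by
  set q := dslope (dslope f z₀) z₀ with hq
  have hqa : AnalyticAt ℂ q z₀ := analyticAt_dslope (analyticAt_dslope hf)
  have hfq : ∀ z, f z = (z - z₀) ^ 2 * q z := fun z => by
    have e1 := sub_smul_dslope f z₀ z
    have e2 := sub_smul_dslope (dslope f z₀) z₀ z
    rw [dslope_same, h1, sub_zero] at e2
    rw [h0, sub_zero] at e1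
    simp only [smul_eq_mul] at e1 e2
    rw [← e1, ← e2]; ring
  -- Dividing `2 q` by `c ^ 2` normalises its value at `z₀` to `1`, so the principal logarithm is
  -- analytic there. Its half gives the square root `W` whose slope is `c` rather than `-c`.
  have hq0 : 2 * q z₀ = c ^ 2 := by
    rw [← h2]
    have e1 : deriv f =ᶠ[𝓝 z₀] fun z => (z - z₀) * (2 * q z + (z - z₀) * deriv q z) := by
      filter_upwards [hqa.eventually_analyticAt] with z hz
      have := (((hasDerivAt_id z).sub_const z₀).fun_pow 2).fun_mul hz.differentiableAt.hasDerivAt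
      rw [funext hfq]
      refine this.deriv.trans ?_
      simp; ring
    rw [e1.deriv_eq]
    have hd : DifferentiableAt ℂ (fun z => 2 * q z + (z - z₀) * deriv q z) z₀ := by
      have := hqa.deriv.differentiableAt
      have := hqa.differentiableAt
      fun_prop
    have := ((hasDerivAt_id z₀).sub_const z₀).fun_mul hd.hasDerivAt
    refine Eq.symm (this.deriv.trans ?_)
    simp
  have hr0 : 2 * q z₀ / c ^ 2 = 1 := by rw [hq0]; exact div_self (pow_ne_zero 2 hc)
  have hra : AnalyticAt ℂ (fun z => 2 * q z / c ^ 2) z₀ := by fun_prop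
  have hEa : AnalyticAt ℂ (fun z => Complex.exp (Complex.log (2 * q z / c ^ 2) / 2)) z₀ := by
    have : AnalyticAt ℂ (fun z => Complex.log (2 * q z / c ^ 2)) z₀ :=
      hra.clog (by rw [hr0]; exact Complex.one_mem_slitPlane)
    fun_prop
  refine ⟨fun z => (z - z₀) * (c * Complex.exp (Complex.log (2 * q z / c ^ 2) / 2)),
    by fun_prop, by simp, ?_, ?_⟩
  · have := ((hasDerivAt_id z₀).sub_const z₀).fun_mul
      (hEa.differentiableAt.hasDerivAt.const_mul c)
    refine this.deriv.trans ?_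
    rw [hr0]; simp
  · have hne : ∀ᶠ z in 𝓝 z₀, 2 * q z / c ^ 2 ≠ 0 :=
      hra.continuousAt.eventually_ne (by rw [hr0]; exact one_ne_zero)
    filter_upwards [hne] with z hz
    rw [hfq z, mul_pow, mul_pow, ← Complex.exp_nat_mul]
    rw [show ((2 : ℕ) : ℂ) * (Complex.log (2 * q z / c ^ 2) / 2) = Complex.log (2 * q z / c ^ 2) by
      push_cast; ring, Complex.exp_log hz]
    field_simp

/-- The only square root of `w ^ 2` that is tangent to `w` is `w`. -/
theorem eventually_eq_of_sq_eq_sq {u : ℂ → ℂ} (hu : HasDerivAt u 1 0) (h0 : u 0 = 0)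
    (h : ∀ᶠ w in 𝓝 0, u w ^ 2 = w ^ 2) : ∀ᶠ w in 𝓝 0, u w = w := by
  have h1 : HasDerivAt (fun w => u w + w) (1 + 1) 0 := hu.fun_add (hasDerivAt_id 0)
  -- The sum `u w + w` has derivative `2`, so it has no zero in a punctured neighbourhood. In the
  -- factored equation the other factor, `u w - w`, must vanish.
  have h2 := h1.eventually_ne (c := 0) (by norm_num)
  rw [eventually_nhdsWithin_iff] at h2
  filter_upwards [h, h2] with w hw hw2
  by_cases hw0 : w = 0
  · rw [hw0, h0]
  · have h3 : (u w - w) * (u w + w) = 0 := by linear_combination hw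
    exact sub_eq_zero.1 ((mul_eq_zero.1 h3).resolve_right (hw2 hw0))

section
variable {x : ℝ}

theorem cexp_saddlePt (hx : 1 < x) : Complex.exp (saddlePt x) = hPar x := by
  rw [← Complex.ofReal_exp, exp_saddlePt hx]

theorem cexp_saddlePt_sub_one_mem_slitPlane (hx : 1 < x) :
    Complex.exp (saddlePt x) - 1 ∈ Complex.slitPlane := by
  rw [cexp_saddlePt hx]
  left
  simpa using one_lt_hPar hx

theorem eventually_mem_slitPlane (hx : 1 < x) :
    ∀ᶠ z in 𝓝 (saddlePt x : ℂ), Complex.exp z - 1 ∈ Complex.slitPlane := by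
  have : ContinuousAt (fun z => Complex.exp z - 1) (saddlePt x : ℂ) := by fun_prop
  exact this.eventually_mem (Complex.isOpen_slitPlane.mem_nhds
    (cexp_saddlePt_sub_one_mem_slitPlane hx))

theorem analyticAt_phase {z : ℂ} (hz : Complex.exp z - 1 ∈ Complex.slitPlane) :
    AnalyticAt ℂ (phase x) z := by
  have : AnalyticAt ℂ (fun z => Complex.log (Complex.exp z - 1)) z :=
    AnalyticAt.clog (by fun_prop) hz
  unfold phase
  fun_prop

theorem hasDerivAt_phase {z : ℂ} (hz : Complex.exp z - 1 ∈ Complex.slitPlane) :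
    HasDerivAt (phase x) (Complex.exp z / (Complex.exp z - 1) - x) z := by
  have h1 : HasDerivAt (fun z => Complex.log (Complex.exp z - 1))
      (Complex.exp z / (Complex.exp z - 1)) z := ((Complex.hasDerivAt_exp z).sub_const 1).clog hz
  have h2 := h1.fun_sub ((hasDerivAt_id z).mul_const (x : ℂ))
  exact h2.congr_deriv (by simp)

theorem eq_hPar_div (hx : 1 < x) : x = hPar x / (hPar x - 1) := by
  have : x - 1 ≠ 0 := by linarith
  rw [hPar]
  field_simp
  ring

/-- The derivative at the origin of the inverse of the saddle change of variables. -/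
def saddleSlope (x : ℝ) : ℂ := Complex.I * (((hPar x - 1) / √(hPar x) : ℝ) : ℂ)

theorem saddleSlope_ne_zero (hx : 1 < x) : saddleSlope x ≠ 0 := by
  have h1 := one_lt_hPar hx
  refine mul_ne_zero Complex.I_ne_zero (Complex.ofReal_ne_zero.2 (div_ne_zero (by linarith) ?_))
  exact (Real.sqrt_pos.2 (by linarith)).ne'

theorem saddleSlope_sq (hx : 1 < x) :
    saddleSlope x ^ 2 = -((hPar x : ℂ) - 1) ^ 2 / hPar x := by
  have h1 := one_lt_hPar hx
  rw [saddleSlope, mul_pow, Complex.I_sq, ← Complex.ofReal_pow, div_pow,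
    Real.sq_sqrt (by linarith)]
  push_cast; ring

/-- At `s₀` the phase has zero derivative and second derivative `-h / (h - 1)²`, the square of
`(saddleSlope x)⁻¹`. A local inverse of the resulting square root `W` is the desired germ. -/
theorem exists_isSaddleInverse (hx : 1 < x) : ∃ s : ℂ → ℂ, IsSaddleInverse x s := by
  have h1 := one_lt_hPar hx
  have hsl := cexp_saddlePt_sub_one_mem_slitPlane hx
  have hne : (hPar x : ℂ) - 1 ≠ 0 := by
    rw [← Complex.ofReal_one, ← Complex.ofReal_sub]; exact Complex.ofReal_ne_zero.2 (by linarith)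
  have hne' : (hPar x : ℂ) ≠ 0 := Complex.ofReal_ne_zero.2 (by linarith)
  have hxh : (x : ℂ) = hPar x / (hPar x - 1) := by exact_mod_cast eq_hPar_div hx
  have hc0 := saddleSlope_ne_zero hx
  obtain ⟨W, hWa, hW0, hW1, hWf⟩ := exists_analyticAt_sq_div_two
    (f := fun z => phase x z - phase x (saddlePt x)) (z₀ := saddlePt x) (c := (saddleSlope x)⁻¹)
    ((analyticAt_phase hsl).fun_sub analyticAt_const) (sub_self _)
    (by rw [deriv_sub_const, (hasDerivAt_phase hsl).deriv, cexp_saddlePt hx, hxh, sub_self])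
    (by
      have e1 : deriv (fun z => phase x z - phase x (saddlePt x)) =ᶠ[𝓝 (saddlePt x : ℂ)]
          fun z => Complex.exp z / (Complex.exp z - 1) - x := by
        filter_upwards [eventually_mem_slitPlane hx] with z hz
        rw [deriv_sub_const, (hasDerivAt_phase hz).deriv]
      have e2 := ((Complex.hasDerivAt_exp (saddlePt x)).fun_div
        ((Complex.hasDerivAt_exp (saddlePt x)).sub_const 1)
        (by rw [cexp_saddlePt hx]; exact hne)).sub_const (x : ℂ)
      rw [e1.deriv_eq, e2.deriv, inv_pow, saddleSlope_sq hx, cexp_saddlePt hx]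
      field_simp
      ring)
    (inv_ne_zero hc0)
  have hW1' : deriv W (saddlePt x) ≠ 0 := by rw [hW1]; exact inv_ne_zero hc0
  have hstr := hWa.hasStrictDerivAt
  have hs0 : hstr.localInverse _ _ _ hW1' 0 = saddlePt x := by
    have := (hstr.eventually_left_inverse hW1').self_of_nhds
    rwa [hW0] at this
  have hsa := hWa.analyticAt_localInverse hW1'
  have hright := hstr.eventually_right_inverse hW1'
  have hsd := (hstr.to_localInverse hW1').hasDerivAt.deriv
  rw [hW0] at hsa hright hsd
  refine ⟨hstr.localInverse _ _ _ hW1', hsa, hs0, ?_, ?_⟩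
  · rw [hsd, hW1, inv_inv]; rfl
  · have ht : Tendsto (hstr.localInverse _ _ _ hW1') (𝓝 0) (𝓝 (saddlePt x : ℂ)) := by
      have := hsa.continuousAt.tendsto
      rwa [hs0] at this
    filter_upwards [hright, ht.eventually hWf] with w hw1 hw2
    rw [hw2, hw1]

/-- The inverse of a saddle inverse is a local coordinate in which the phase is quadratic. -/
theorem IsSaddleInverse.exists_coordinate (hx : 1 < x) {s : ℂ → ℂ} (hs : IsSaddleInverse x s) :
    ∃ W : ℂ → ℂ, AnalyticAt ℂ W (saddlePt x) ∧ W (saddlePt x) = 0 ∧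
      deriv W (saddlePt x) = (saddleSlope x)⁻¹ ∧
      (∀ᶠ z in 𝓝 (saddlePt x : ℂ), s (W z) = z) ∧
      ∀ᶠ z in 𝓝 (saddlePt x : ℂ), phase x z - phase x (saddlePt x) = W z ^ 2 / 2 := by
  have hd : deriv s 0 ≠ 0 := by rw [hs.deriv_zero]; exact saddleSlope_ne_zero hx
  have hstr := hs.analyticAt.hasStrictDerivAt
  have hWa := hs.analyticAt.analyticAt_localInverse hd
  have hW0 : hstr.localInverse _ _ _ hd (s 0) = 0 :=
    (hstr.eventually_left_inverse hd).self_of_nhds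
  have hright := hstr.eventually_right_inverse hd
  have hWd := (hstr.to_localInverse hd).hasDerivAt.deriv
  have ht := hWa.continuousAt.tendsto
  rw [hW0] at ht
  have hph := ht.eventually hs.phase_eq
  rw [hs.map_zero] at hWa hW0 hright hWd hph
  refine ⟨hstr.localInverse _ _ _ hd, hWa, hW0, ?_, hright, ?_⟩
  · rw [hWd, hs.deriv_zero]; rfl
  · filter_upwards [hright, hph] with z h1 h2
    rw [← h2, h1]

/-- With `W` the inverse of `s₂`, the composite `W ∘ s₁` squares to `w ^ 2`, and the common slope
makes it tangent to `w`; hence it is `w`. -/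
theorem IsSaddleInverse.eventuallyEq (hx : 1 < x) {s₁ s₂ : ℂ → ℂ} (h₁ : IsSaddleInverse x s₁)
    (h₂ : IsSaddleInverse x s₂) : s₁ =ᶠ[𝓝 0] s₂ := by
  obtain ⟨W, hWa, hW0, hW1, hsW, hph⟩ := h₂.exists_coordinate hx
  have ht : Tendsto s₁ (𝓝 0) (𝓝 (saddlePt x : ℂ)) := by
    have := h₁.analyticAt.continuousAt.tendsto
    rwa [h₁.map_zero] at this
  have hd : HasDerivAt (fun w => W (s₁ w)) 1 0 := by
    have e1 : HasDerivAt W (saddleSlope x)⁻¹ (s₁ 0) := by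
      rw [h₁.map_zero, ← hW1]; exact hWa.differentiableAt.hasDerivAt
    have e2 : HasDerivAt s₁ (saddleSlope x) 0 := by
      rw [saddleSlope, ← h₁.deriv_zero]; exact h₁.analyticAt.differentiableAt.hasDerivAt
    exact (e1.comp 0 e2).congr_deriv (inv_mul_cancel₀ (saddleSlope_ne_zero hx))
  have hsq : ∀ᶠ w in 𝓝 0, W (s₁ w) ^ 2 = w ^ 2 := by
    filter_upwards [ht.eventually hph, h₁.phase_eq] with w e1 e2
    rw [e1] at e2
    linear_combination 2 * e2
  filter_upwards [eventually_eq_of_sq_eq_sq hd (by rw [h₁.map_zero, hW0]) hsq,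
    ht.eventually hsW] with w e1 e2
  rw [← e2, e1]

theorem IsSaddleInverse.logDerivCoeff_eq (hx : 1 < x) {s₁ s₂ : ℂ → ℂ} (h₁ : IsSaddleInverse x s₁)
    (h₂ : IsSaddleInverse x s₂) (m : ℕ) : logDerivCoeff s₁ m = logDerivCoeff s₂ m := by
  have h := h₁.eventuallyEq hx h₂
  unfold logDerivCoeff
  congr 1
  refine Filter.EventuallyEq.iteratedDeriv_eq m ?_
  filter_upwards [h, h.deriv] with w e1 e2
  rw [e1, e2]

open ComplexConjugate

theorem phase_conj {z : ℂ} (hz : Complex.exp z - 1 ∈ Complex.slitPlane) :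
    phase x (conj z) = conj (phase x z) := by
  have : Complex.exp (conj z) - 1 = conj (Complex.exp z - 1) := by
    rw [map_sub, map_one, Complex.exp_conj]
  rw [phase, phase, this, Complex.log_conj _ (Complex.slitPlane_arg_ne_pi hz), map_sub, map_mul,
    Complex.conj_ofReal]

/-- The phase commutes with conjugation near `s₀`. Conjugation reverses the purely imaginary slope,
and `w ↦ -w`, which keeps `w ^ 2`, restores it. -/
theorem IsSaddleInverse.conj_neg (hx : 1 < x) {s : ℂ → ℂ} (hs : IsSaddleInverse x s) :
    IsSaddleInverse x (fun w => (conj ∘ s ∘ conj) (-w)) := by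
  have ht : Tendsto s (𝓝 0) (𝓝 (saddlePt x : ℂ)) := by
    have := hs.analyticAt.continuousAt.tendsto
    rwa [hs.map_zero] at this
  have hc : Tendsto (fun w : ℂ => conj (-w)) (𝓝 0) (𝓝 0) := by
    have : Continuous fun w : ℂ => conj (-w) := by fun_prop
    simpa using this.tendsto 0
  refine ⟨?_, by simp [hs.map_zero], ?_, ?_⟩
  · have h1 : AnalyticAt ℂ (conj ∘ s ∘ conj) (-0) := by
      rw [neg_zero, Complex.analyticAt_iff_eventually_differentiableAt]
      have h2 := Complex.analyticAt_iff_eventually_differentiableAt.1 hs.analyticAt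
      have hc' : Tendsto (fun w : ℂ => conj w) (𝓝 0) (𝓝 0) := by
        simpa using Complex.continuous_conj.tendsto 0
      filter_upwards [hc'.eventually h2] with w hw
      simpa using hw.conj_conj
    exact h1.fun_comp analyticAt_id.neg
  · rw [deriv_comp_neg, deriv_conj_conj]
    simp [hs.deriv_zero]
  · filter_upwards [hc.eventually hs.phase_eq,
      hc.eventually (ht.eventually (eventually_mem_slitPlane hx))] with w e1 e2
    have e3 : (conj ∘ s ∘ conj) (-w) = conj (s (conj (-w))) := rfl
    have e4 : phase x (saddlePt x) = conj (phase x (saddlePt x)) := by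
      rw [← phase_conj (cexp_saddlePt_sub_one_mem_slitPlane hx), Complex.conj_ofReal]
    rw [e3, phase_conj e2, e4, ← map_sub, e1]
    simp [Complex.conj_ofNat]

theorem IsSaddleInverse.logDerivCoeff_re (hx : 1 < x) {s : ℂ → ℂ} (hs : IsSaddleInverse x s)
    (k : ℕ) : (logDerivCoeff s (2 * k)).re = 0 := by
  have h1 := hs.logDerivCoeff_eq hx (hs.conj_neg hx) (2 * k)
  have hit : ∀ (m : ℕ) (f : ℂ → ℂ),
      iteratedDeriv m (conj ∘ f ∘ conj) = conj ∘ iteratedDeriv m f ∘ conj := by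
    intro m
    induction m with
    | zero => intro f; simp
    | succ m ih => intro f; rw [iteratedDeriv_succ', deriv_conj_conj, ih, ← iteratedDeriv_succ']
  set R : ℂ → ℂ := fun w => (1 / s w) * deriv s w with hR
  have h2 : (fun w => (1 / (conj ∘ s ∘ conj) (-w)) * deriv (fun w => (conj ∘ s ∘ conj) (-w)) w) =
      fun w => (conj ∘ (fun z => -R z) ∘ conj) (-w) := by
    ext w
    rw [deriv_comp_neg, deriv_conj_conj]
    simp [hR]
  -- Under the symmetry `s' / s` acquires one minus sign from the chain rule, while reflection does
  -- not affect an even coefficient.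
  have h3 : logDerivCoeff s (2 * k) = -conj (logDerivCoeff s (2 * k)) := by
    conv_lhs => rw [h1]
    unfold logDerivCoeff
    rw [h2, iteratedDeriv_comp_neg, hit, pow_mul]
    rw [map_div₀, Complex.conj_natCast, ← neg_div]
    congr 1
    rw [← map_neg, ← iteratedDeriv_fun_neg]
    simp [hR]
  have h4 := congrArg Complex.re h3
  rw [Complex.neg_re, Complex.conj_re] at h4
  linarith

end
end

/-! ### From the contour segment to a real Gaussian integral -/

noncomputable section

open Filter Topology

theorem norm_cexp_neg_sq_lt_one {w : ℂ} (h : 0 < (w ^ 2).re) : ‖Complex.exp (-(w ^ 2 / 2))‖ < 1 := by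
  rw [Complex.norm_exp, Real.exp_lt_one_iff, Complex.neg_re,
    show w ^ 2 / 2 = w ^ 2 / ((2 : ℝ) : ℂ) by norm_num, Complex.div_ofReal_re]
  linarith

/-- Moving an endpoint of a Gaussian contour integral to its real part costs a geometrically small
amount. -/
theorem geomSmall_primitive_sub_re {g : ℂ → ℂ} {H : ℕ → ℂ → ℂ} {R : ℝ}
    (hg : ContinuousOn g (Metric.ball 0 R))
    (hH : ∀ n, ∀ w ∈ Metric.ball (0 : ℂ) R,
      HasDerivAt (H n) (Complex.exp (-(w ^ 2 / 2)) ^ n * g w) w)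
    {p : ℂ} (hp : p ∈ Metric.ball (0 : ℂ) R) (hp2 : 0 < (p ^ 2).re) :
    GeomSmall fun n => H n p - H n p.re := by
  have habs : ∀ y ∈ Set.uIcc 0 p.im, |y| ≤ |p.im| := fun y hy => by
    rcases Set.mem_uIcc.1 hy with h | h
    · rw [abs_of_nonneg h.1, abs_of_nonneg (h.1.trans h.2)]; exact h.2
    · rw [abs_of_nonpos h.2, abs_of_nonpos (h.1.trans h.2)]; linarith [h.1]
  have hmem : ∀ y ∈ Set.uIcc 0 p.im, (p.re : ℂ) + y * Complex.I ∈ Metric.ball (0 : ℂ) R := by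
    intro y hy
    rw [mem_ball_zero_iff] at hp ⊢
    refine lt_of_le_of_lt ?_ hp
    refine le_of_sq_le_sq ?_ (norm_nonneg p)
    rw [Complex.sq_norm, Complex.sq_norm, Complex.normSq_add_mul_I, Complex.normSq_apply]
    nlinarith [sq_le_sq.2 (habs y hy)]
  have hgc : ContinuousOn (fun y : ℝ => g ((p.re : ℂ) + y * Complex.I)) (Set.uIcc 0 p.im) :=
    hg.comp (by fun_prop) hmem
  have hec : Continuous fun y : ℝ =>
      Complex.exp (-(((p.re : ℂ) + y * Complex.I) ^ 2 / 2)) := by fun_prop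
  -- On the vertical segment from `p.re` to `p` the real part of `w ^ 2` is `p.re² - y²`, at least
  -- that of `p ^ 2`, hence positive.
  have h1 := geomSmall_integral hec.continuousOn hgc fun y hy => by
    refine norm_cexp_neg_sq_lt_one ?_
    have h2 := sq_le_sq.2 (habs y hy)
    simp only [pow_two, Complex.mul_re, Complex.add_re, Complex.add_im, Complex.ofReal_re,
      Complex.ofReal_im, Complex.I_re, Complex.I_im, Complex.mul_im] at hp2 h2 ⊢
    linarith
  have h3 := h1.const_mul Complex.I
  convert h3 using 2 with n
  rw [integral_vertical_of_hasDerivAt (F := H n)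
    (f := fun w => Complex.exp (-(w ^ 2 / 2)) ^ n * g w) (fun y hy => hH n _ (hmem y hy))
    ((hec.continuousOn.fun_pow n).fun_mul hgc)]
  simp [Complex.re_add_im]

theorem saddleRatio_eq_cexp {x : ℝ} (hx : 1 < x) {z : ℂ}
    (hz : Complex.exp z - 1 ∈ Complex.slitPlane) :
    saddleRatio x z = Complex.exp (-(phase x z - phase x (saddlePt x))) := by
  have h1 := one_lt_hPar hx
  have h2 : ∀ z : ℂ, Complex.exp z - 1 ∈ Complex.slitPlane →
      Complex.exp (phase x z) = (Complex.exp z - 1) / Complex.exp (x * z) := fun z hz => by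
    rw [phase, Complex.exp_sub, Complex.exp_log (Complex.slitPlane_ne_zero hz), mul_comm z]
  have h3 : Complex.exp (x * saddlePt x) = ((hPar x ^ x : ℝ) : ℂ) := by
    rw [← Complex.ofReal_mul, ← Complex.ofReal_exp, ← exp_saddlePt hx, ← Real.exp_mul, mul_comm]
  rw [neg_sub, Complex.exp_sub, h2 z hz, h2 _ (cexp_saddlePt_sub_one_mem_slitPlane hx), h3,
    cexp_saddlePt hx, saddleRatio]
  have h4 := Complex.slitPlane_ne_zero hz
  push_cast
  field_simp

theorem eventually_sign_of_hasDerivAt {f : ℝ → ℝ} {f' : ℝ} (h : HasDerivAt f f' 0) (h0 : f 0 = 0)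
    (hp : 0 < f') : ∀ᶠ y in 𝓝[>] 0, 0 < f y ∧ f (-y) < 0 := by
  have h1 := eventually_nhdsWithin_sign_eq_of_deriv_pos (by rw [h.deriv]; exact hp) h0
  rw [eventually_nhds_iff] at h1
  obtain ⟨U, hU, hUo, hU0⟩ := h1
  have e1 : ∀ᶠ y in 𝓝[>] (0 : ℝ), y ∈ U := mem_nhdsWithin_of_mem_nhds (hUo.mem_nhds hU0)
  have e2 : ∀ᶠ y in 𝓝[>] (0 : ℝ), -y ∈ U := by
    have : Tendsto (fun y : ℝ => -y) (𝓝 0) (𝓝 0) := by simpa using (continuous_neg.tendsto (0 : ℝ))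
    exact mem_nhdsWithin_of_mem_nhds (this.eventually (hUo.mem_nhds hU0))
  filter_upwards [e1, e2, self_mem_nhdsWithin] with y h1 h2 h3
  have h3' : 0 < y := h3
  have h4 := hU y h1
  have h5 := hU (-y) h2
  rw [sub_zero, sign_pos h3'] at h4
  rw [sub_zero, sign_neg (show -y < 0 by linarith)] at h5
  exact ⟨sign_eq_one_iff.1 h4, sign_eq_neg_one_iff.1 h5⟩

theorem IsSaddleInverse.analyticAt_logDeriv {x : ℝ} (hx : 1 < x) {s : ℂ → ℂ}
    (hs : IsSaddleInverse x s) : AnalyticAt ℂ (fun w => (1 / s w) * deriv s w) 0 := by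
  have h0 : s 0 ≠ 0 := by
    rw [hs.map_zero]; exact Complex.ofReal_ne_zero.2 (saddlePt_pos hx).ne'
  exact (analyticAt_const.fun_div hs.analyticAt h0).fun_mul hs.analyticAt.deriv

/-- In the saddle coordinate the central part of the contour integral is a Gaussian integral. -/
theorem IsSaddleInverse.exists_geomSmall_sub_gaussian {x : ℝ} (hx : 1 < x) {s : ℂ → ℂ}
    (hs : IsSaddleInverse x s) :
    ∃ ε a b : ℝ, 0 < ε ∧ ε < Real.pi ∧ 0 < a ∧ 0 < b ∧
      ContinuousOn (fun t : ℝ => (1 / s t) * deriv s t) (Set.Icc (-a) b) ∧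
      GeomSmall fun n => saddleIntegral x ε n -
        ∫ t in (-a)..b, Complex.exp (-((t : ℂ) ^ 2 / 2)) ^ n * ((1 / s t) * deriv s t) := by
  set g : ℂ → ℂ := fun w => (1 / s w) * deriv s w with hgdef
  have hga : AnalyticAt ℂ g 0 := hs.analyticAt_logDeriv hx
  obtain ⟨W, hWa, hW0, hW1, hsW, hph⟩ := hs.exists_coordinate hx
  have hWt : Tendsto W (𝓝 (saddlePt x : ℂ)) (𝓝 0) := by
    have := hWa.continuousAt.tendsto
    rwa [hW0] at this
  obtain ⟨R, hR, hRg⟩ := Metric.eventually_nhds_iff_ball.1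
    (hga.eventually_analyticAt.and hs.analyticAt.eventually_analyticAt)
  have hgd : DifferentiableOn ℂ g (Metric.ball 0 R) := fun w hw =>
    (hRg w hw).1.differentiableAt.differentiableWithinAt
  -- A primitive on the disc makes the integral depend on the endpoints alone, so the image curve
  -- under `W` never has to be parametrised or deformed.
  have hGn : ∀ n : ℕ, ∃ H : ℂ → ℂ, ∀ w ∈ Metric.ball (0 : ℂ) R,
      HasDerivAt H (Complex.exp (-(w ^ 2 / 2)) ^ n * g w) w := fun n =>
    DifferentiableOn.isExactOn_ball (by fun_prop)
  choose H hH using hGn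
  have hloc := ((hWt.eventually (Metric.ball_mem_nhds 0 hR)).and hWa.eventually_analyticAt).and
    ((hsW.eventually_nhds.and hph).and (eventually_mem_slitPlane hx))
  have hline : Tendsto (fun y : ℝ => (saddlePt x : ℂ) + y * Complex.I) (𝓝 0)
      (𝓝 (saddlePt x : ℂ)) := by
    have : Continuous fun y : ℝ => (saddlePt x : ℂ) + y * Complex.I := by fun_prop
    simpa using this.tendsto 0
  obtain ⟨δ, hδ, hδl⟩ := Metric.eventually_nhds_iff_ball.1 (hline.eventually hloc)
  -- The slope `i (h - 1) / √h` sends the upward direction at `s₀` to the positive real direction in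
  -- `w`, so the endpoints have real parts of opposite sign around `0`.
  have hre : HasDerivAt (fun y : ℝ => (W ((saddlePt x : ℂ) + y * Complex.I)).re)
      (√(hPar x) / (hPar x - 1)) 0 := by
    have e1 : HasDerivAt W (saddleSlope x)⁻¹ ((saddlePt x : ℂ) + (0 : ℂ) * Complex.I) := by
      rw [← hW1, zero_mul, add_zero]; exact hWa.differentiableAt.hasDerivAt
    have e2 : HasDerivAt (fun y : ℂ => (saddlePt x : ℂ) + y * Complex.I) Complex.I 0 := by
      simpa using ((hasDerivAt_id (0 : ℂ)).mul_const Complex.I).const_add (saddlePt x : ℂ)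
    have e3 : HasDerivAt (fun y : ℂ => W ((saddlePt x : ℂ) + y * Complex.I))
        ((saddleSlope x)⁻¹ * Complex.I) ((0 : ℝ) : ℂ) := by
      rw [Complex.ofReal_zero]; exact HasDerivAt.comp (0 : ℂ) e1 e2
    refine e3.real_of_complex.congr_deriv ?_
    have : (saddleSlope x)⁻¹ * Complex.I = ((√(hPar x) / (hPar x - 1) : ℝ) : ℂ) := by
      rw [saddleSlope, mul_inv, mul_assoc, mul_comm, mul_assoc, Complex.mul_inv_cancel
        Complex.I_ne_zero, mul_one, ← Complex.ofReal_inv, inv_div]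
    rw [this, Complex.ofReal_re]
  have h1 := one_lt_hPar hx
  have hsign := eventually_sign_of_hasDerivAt hre (by simp [hW0])
    (div_pos (Real.sqrt_pos.2 (by linarith)) (by linarith))
  have hsmall : ∀ᶠ y in 𝓝[>] (0 : ℝ), y < min δ Real.pi :=
    mem_nhdsWithin_of_mem_nhds (Iio_mem_nhds (lt_min hδ Real.pi_pos))
  obtain ⟨ε, ⟨⟨hb, ha⟩, hε1⟩, hε0⟩ := ((hsign.and hsmall).and self_mem_nhdsWithin).exists
  have hε0 : 0 < ε := hε0
  have hεδ : ε < δ := hε1.trans_le (min_le_left _ _)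
  have hεπ : ε < Real.pi := hε1.trans_le (min_le_right _ _)
  have hloc' : ∀ y ∈ Set.uIcc (-ε) ε, y ∈ Metric.ball (0 : ℝ) δ := fun y hy => by
    rw [Set.uIcc_of_le (by linarith)] at hy
    rw [mem_ball_zero_iff, Real.norm_eq_abs, abs_lt]
    exact ⟨by linarith [hy.1], by linarith [hy.2]⟩
  -- Since `saddleRatio = exp(-W² / 2)`, modulus below `1` says exactly that `W ^ 2` has positive
  -- real part.
  have hsq : ∀ y ∈ Set.uIcc (-ε) ε, Real.cos y < 1 →
      0 < (W ((saddlePt x : ℂ) + y * Complex.I) ^ 2).re := fun y hy hc => by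
    obtain ⟨-, ⟨-, e1⟩, e2⟩ := hδl y (hloc' y hy)
    have e3 := norm_saddleRatio_lt_one_vertical hx (t := (saddlePt x : ℂ) + y * Complex.I)
      (by simp) (by simpa using hc)
    rw [saddleRatio_eq_cexp hx e2, e1, Complex.norm_exp, Real.exp_lt_one_iff, Complex.neg_re,
      show (2 : ℂ) = ((2 : ℝ) : ℂ) by norm_num, Complex.div_ofReal_re] at e3
    linarith
  have hcos : Real.cos ε < 1 := by
    rw [← Real.cos_zero]
    exact Real.cos_lt_cos_of_nonneg_of_le_pi le_rfl hεπ.le hε0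
  have hmid : ∀ n, saddleIntegral x ε n = H n (W ((saddlePt x : ℂ) + (ε : ℝ) * Complex.I)) -
      H n (W ((saddlePt x : ℂ) + (-ε : ℝ) * Complex.I)) := fun n => by
    refine integral_vertical_of_hasDerivAt (F := fun z => H n (W z))
      (f := fun z => saddleRatio x z ^ n * z⁻¹) (fun y hy => ?_) ?_
    · obtain ⟨⟨e1, e2⟩, ⟨e3, e4⟩, e5⟩ := hδl y (hloc' y hy)
      set z := (saddlePt x : ℂ) + y * Complex.I
      have d1 := (hH n _ e1).comp z e2.differentiableAt.hasDerivAt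
      refine d1.congr_deriv ?_
      have hsz : s (W z) = z := e3.self_of_nhds
      have d2 : deriv s (W z) * deriv W z = 1 := by
        have d3 := ((hRg _ e1).2.differentiableAt.hasDerivAt).comp z
          e2.differentiableAt.hasDerivAt
        have d4 : (s ∘ W) =ᶠ[𝓝 z] id := e3
        rw [← d3.deriv, d4.deriv_eq, deriv_id]
      rw [saddleRatio_eq_cexp hx e5, e4, hgdef]
      simp only
      rw [hsz]
      linear_combination Complex.exp (-(W z ^ 2 / 2)) ^ n * z⁻¹ * d2
    · have hc := continuousOn_right (p := 1) (saddlePt_pos hx) (continuousOn_saddleRatio x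
        (r := ε) (by rw [abs_of_pos hε0]; linarith))
      have hci := continuousOn_right (p := 1) (r := ε) (saddlePt_pos hx)
        (continuousOn_inv_pow 1)
      simp only [pow_one] at hci
      exact (hc.fun_pow n).fun_mul hci
  set zp := W ((saddlePt x : ℂ) + (ε : ℝ) * Complex.I) with hzp
  set zm := W ((saddlePt x : ℂ) + (-ε : ℝ) * Complex.I) with hzm
  have hzpR : zp ∈ Metric.ball (0 : ℂ) R := (hδl ε (hloc' ε Set.right_mem_uIcc)).1.1
  have hzmR : zm ∈ Metric.ball (0 : ℂ) R := (hδl (-ε) (hloc' (-ε) Set.left_mem_uIcc)).1.1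
  have hreal : ∀ t ∈ Set.uIcc zm.re zp.re, (t : ℂ) ∈ Metric.ball (0 : ℂ) R := fun t ht => by
    rw [Set.uIcc_of_le (by linarith)] at ht
    rw [mem_ball_zero_iff] at hzpR hzmR ⊢
    rw [Complex.norm_real, Real.norm_eq_abs, abs_lt]
    have i1 := (abs_lt.1 ((Complex.abs_re_le_norm zp).trans_lt hzpR)).2
    have i2 := (abs_lt.1 ((Complex.abs_re_le_norm zm).trans_lt hzmR)).1
    exact ⟨by linarith [ht.1], by linarith [ht.2]⟩
  have hgc : ContinuousOn (fun t : ℝ => g t) (Set.uIcc zm.re zp.re) :=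
    hgd.continuousOn.comp (by fun_prop) hreal
  refine ⟨ε, -zm.re, zp.re, hε0, hεπ, by linarith, hb, ?_, ?_⟩
  · rw [neg_neg, ← Set.uIcc_of_le (by linarith)]; exact hgc
  · have k1 := geomSmall_primitive_sub_re hgd.continuousOn hH hzpR
      (hsq ε Set.right_mem_uIcc hcos)
    have k2 := geomSmall_primitive_sub_re hgd.continuousOn hH hzmR
      (hsq (-ε) Set.left_mem_uIcc (by rwa [Real.cos_neg]))
    have k3 := k1.sub k2
    convert k3 using 2 with n
    rw [hmid n, neg_neg]
    have : ∫ t in zm.re..zp.re, Complex.exp (-((t : ℂ) ^ 2 / 2)) ^ n * ((1 / s t) * deriv s t) =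
        H n zp.re - H n zm.re :=
      intervalIntegral.integral_eq_sub_of_hasDerivAt (f := fun t : ℝ => H n t)
        (fun t ht => (hH n _ (hreal t ht)).comp_ofReal)
        (ContinuousOn.intervalIntegrable (ContinuousOn.fun_mul (by fun_prop) hgc))
    rw [this]
    ring

end

/-! ### Gaussian moments and Laplace's method -/

noncomputable section

open Filter Topology MeasureTheory

/-- This is the source of `(1/2)_k` in the expansion: the even Gaussian moments are values of `Γ` at
half-integers. -/
theorem Gamma_nat_add_half_eq_ascPochhammer (k : ℕ) :
    Real.Gamma (k + 1 / 2) = (ascPochhammer ℝ k).eval (1 / 2) * √Real.pi := by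
  induction k with
  | zero => simp [← Real.Gamma_one_half_eq]
  | succ k ih =>
    rw [ascPochhammer_succ_eval]
    push_cast
    rw [show (k : ℝ) + 1 + 1 / 2 = (k + 1 / 2) + 1 by ring,
      Real.Gamma_add_one (by positivity), ih]
    ring

theorem integrable_pow_mul_gaussian {b : ℝ} (hb : 0 < b) (m : ℕ) :
    Integrable fun t : ℝ => t ^ m * Real.exp (-b * t ^ 2) := by
  have := integrable_rpow_mul_exp_neg_mul_sq hb (s := m)
    (by have : (0 : ℝ) ≤ m := m.cast_nonneg
        linarith)
  simpa only [Real.rpow_natCast] using this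

theorem integral_even_pow_mul_gaussian {c : ℝ} (hc : 0 < c) (k : ℕ) :
    ∫ t : ℝ, t ^ (2 * k) * Real.exp (-(c / 2) * t ^ 2) =
      √(2 * Real.pi / c) * (2 ^ k * (ascPochhammer ℝ k).eval (1 / 2) / c ^ k) := by
  have h1 := integral_comp_abs (f := fun t : ℝ => t ^ (2 * k) * Real.exp (-(c / 2) * t ^ 2))
  have h2 : ∀ t : ℝ, |t| ^ (2 * k) = t ^ (2 * k) := fun t => by rw [pow_mul, sq_abs, ← pow_mul]
  simp only [h2, sq_abs] at h1
  have h3 := integral_rpow_mul_exp_neg_mul_rpow (p := 2) (q := (2 * k : ℕ)) (b := c / 2)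
    (by norm_num) (by have : (0 : ℝ) ≤ (2 * k : ℕ) := Nat.cast_nonneg _
                      linarith) (by positivity)
  simp only [Real.rpow_natCast, Real.rpow_two] at h3
  rw [h1, h3]
  push_cast
  rw [show (2 * (k : ℝ) + 1) / 2 = k + 1 / 2 by ring, Gamma_nat_add_half_eq_ascPochhammer,
    show -(2 * (k : ℝ) + 1) / 2 = -(k + 1 / 2) by ring,
    Real.rpow_neg (by positivity), Real.rpow_add (by positivity), Real.rpow_natCast,
    ← Real.sqrt_eq_rpow, show 2 * Real.pi / c = Real.pi / (c / 2) by field_simp,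
    Real.sqrt_div Real.pi_pos.le, div_pow]
  have : √(c / 2) ≠ 0 := (Real.sqrt_pos.2 (by positivity)).ne'
  field_simp

theorem integral_odd_pow_mul_gaussian (b : ℝ) (k : ℕ) :
    ∫ t : ℝ, t ^ (2 * k + 1) * Real.exp (-b * t ^ 2) = 0 := by
  have h := integral_neg_eq_self (fun t : ℝ => t ^ (2 * k + 1) * Real.exp (-b * t ^ 2)) volume
  have h2 : ∀ t : ℝ, (-t) ^ (2 * k + 1) * Real.exp (-b * (-t) ^ 2) =
      -(t ^ (2 * k + 1) * Real.exp (-b * t ^ 2)) := fun t => by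
    rw [neg_sq, Odd.neg_pow ⟨k, rfl⟩, neg_mul]
  simp only [h2, integral_neg] at h
  linarith

/-- A function cut off to an interval differs from its Taylor polynomial by a power, on the whole
line. -/
theorem exists_norm_indicator_sub_le {g : ℂ → ℂ} (hg : AnalyticAt ℂ g 0) {a b : ℝ} (ha : 0 < a)
    (hb : 0 < b) (hgc : ContinuousOn (fun t : ℝ => g t) (Set.Icc (-a) b)) (M : ℕ) :
    ∃ C : ℝ, ∀ t : ℝ, ‖(Set.Ioc (-a) b).indicator (fun t : ℝ => g t) t -
      ∑ m ∈ Finset.range M, PowerSeries.coeff m (taylorSeries g) * (t : ℂ) ^ m‖ ≤ C * |t| ^ M := by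
  have h1 := hg.hasFPowerSeriesAt.isBigO_sub_partialSum_pow M
  obtain ⟨C₁, hC₁⟩ := h1.bound
  obtain ⟨δ, hδ, hδ1⟩ := Metric.eventually_nhds_iff_ball.1 hC₁
  obtain ⟨D, hD⟩ := isCompact_Icc.exists_bound_of_continuousOn hgc
  have hD0 : 0 ≤ D := (norm_nonneg _).trans (hD 0 ⟨by linarith, hb.le⟩)
  set d := min δ (min a b) with hd
  have hd0 : 0 < d := lt_min hδ (lt_min ha hb)
  set S := ∑ m ∈ Finset.range M, ‖PowerSeries.coeff m (taylorSeries g)‖ * d ^ m with hS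
  have hS0 : 0 ≤ S := Finset.sum_nonneg fun m _ => by positivity
  -- The first constant is the Taylor remainder bound for `|t| < d`. For `|t| ≥ d` the function is
  -- bounded and the polynomial has degree below `M`, so both are at most a multiple of `(|t| / d) ^
  -- M`.
  refine ⟨max C₁ ((D + S) / d ^ M), fun t => ?_⟩
  by_cases ht : |t| < d
  · have h2 := hδ1 t (by
      rw [mem_ball_zero_iff, Complex.norm_real, Real.norm_eq_abs]
      exact ht.trans_le (min_le_left _ _))
    have h3 : t ∈ Set.Ioc (-a) b := by
      have h4 := abs_lt.1 ht
      have h5 : d ≤ a := (min_le_right _ _).trans (min_le_left _ _)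
      have h6 : d ≤ b := (min_le_right _ _).trans (min_le_right _ _)
      exact ⟨by linarith, by linarith⟩
    rw [Set.indicator_of_mem h3]
    rw [zero_add, norm_pow, norm_norm, Complex.norm_real, Real.norm_eq_abs] at h2
    have h7 : (FormalMultilinearSeries.ofScalars ℂ
        fun n => iteratedDeriv n g 0 / (n.factorial : ℂ)).partialSum M (t : ℂ) =
        ∑ m ∈ Finset.range M, PowerSeries.coeff m (taylorSeries g) * (t : ℂ) ^ m := by
      rw [FormalMultilinearSeries.partialSum]
      refine Finset.sum_congr rfl fun m _ => ?_
      rw [FormalMultilinearSeries.ofScalars_apply_eq, coeff_taylorSeries, smul_eq_mul]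
    rw [h7] at h2
    exact h2.trans (mul_le_mul_of_nonneg_right (le_max_left _ _) (by positivity))
  · push Not at ht
    have hu : 1 ≤ |t| / d := (one_le_div hd0).2 ht
    have h2 : ‖(Set.Ioc (-a) b).indicator (fun t : ℝ => g t) t‖ ≤ D * (|t| / d) ^ M := by
      have : ‖(Set.Ioc (-a) b).indicator (fun t : ℝ => g t) t‖ ≤ D := by
        by_cases h3 : t ∈ Set.Ioc (-a) b
        · rw [Set.indicator_of_mem h3]; exact hD t ⟨h3.1.le, h3.2⟩
        · rw [Set.indicator_of_notMem h3, norm_zero]; exact hD0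
      exact this.trans (le_mul_of_one_le_right hD0 (one_le_pow₀ hu))
    have h3 : ‖∑ m ∈ Finset.range M, PowerSeries.coeff m (taylorSeries g) * (t : ℂ) ^ m‖ ≤
        S * (|t| / d) ^ M := by
      rw [hS, Finset.sum_mul]
      refine norm_sum_le_of_le _ fun m hm => ?_
      rw [norm_mul, norm_pow, Complex.norm_real, Real.norm_eq_abs, mul_assoc]
      refine mul_le_mul_of_nonneg_left ?_ (norm_nonneg _)
      calc |t| ^ m = d ^ m * (|t| / d) ^ m := by rw [← mul_pow]; congr 1; field_simp
        _ ≤ _ := mul_le_mul_of_nonneg_left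
          (pow_le_pow_right₀ hu (Finset.mem_range.1 hm).le) (by positivity)
    calc _ ≤ D * (|t| / d) ^ M + S * (|t| / d) ^ M := (norm_sub_le _ _).trans (add_le_add h2 h3)
      _ = (D + S) / d ^ M * |t| ^ M := by rw [div_pow]; ring
      _ ≤ _ := mul_le_mul_of_nonneg_right (le_max_right _ _) (by positivity)

theorem sum_range_two_mul {M : Type*} [AddCommMonoid M] (f : ℕ → M) (N : ℕ) :
    ∑ m ∈ Finset.range (2 * N), f m = ∑ k ∈ Finset.range N, (f (2 * k) + f (2 * k + 1)) := by
  induction N with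
  | zero => simp
  | succ N ih =>
    rw [mul_add, mul_one, Finset.sum_range_succ, Finset.sum_range_succ, ih, Finset.sum_range_succ,
      add_assoc]

/-- Laplace's method for a Gaussian weight: the asymptotic expansion of the integral of an analytic
function, with a uniform remainder. -/
theorem exists_gaussian_expansion {g : ℂ → ℂ} (hg : AnalyticAt ℂ g 0) {a b : ℝ} (ha : 0 < a)
    (hb : 0 < b) (hgc : ContinuousOn (fun t : ℝ => g t) (Set.Icc (-a) b)) (N : ℕ) :
    ∃ C : ℝ, ∀ c : ℝ, 0 < c →
      ‖(∫ t in (-a)..b, (Real.exp (-(c / 2) * t ^ 2) : ℂ) * g t) -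
        (√(2 * Real.pi / c) : ℂ) * ∑ k ∈ Finset.range N,
          PowerSeries.coeff (2 * k) (taylorSeries g) *
            ((2 ^ k * (ascPochhammer ℝ k).eval (1 / 2) / c ^ k : ℝ) : ℂ)‖ ≤
      C * (√(2 * Real.pi / c) / c ^ N) := by
  -- Order `2 * N` keeps exactly `N` even terms, and the remainder integrates to the moment of order
  -- `2 * N`, of size `c⁻ᴺ`. The bound holds on the whole line, so no separate tail estimate is
  -- needed.
  obtain ⟨C, hC⟩ := exists_norm_indicator_sub_le hg ha hb hgc (2 * N)
  refine ⟨C * (2 ^ N * (ascPochhammer ℝ N).eval (1 / 2)), fun c hc => ?_⟩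
  set E : ℝ → ℝ := fun t => Real.exp (-(c / 2) * t ^ 2) with hE
  have hmom : ∀ m : ℕ, Integrable fun t : ℝ => t ^ m * E t :=
    fun m => integrable_pow_mul_gaussian (by positivity) m
  have hterm : ∀ m : ℕ, Integrable fun t : ℝ =>
      PowerSeries.coeff m (taylorSeries g) * ((t ^ m * E t : ℝ) : ℂ) :=
    fun m => (hmom m).ofReal.const_mul _
  have hmain : Integrable fun t : ℝ =>
      (Set.Ioc (-a) b).indicator (fun t : ℝ => (E t : ℂ) * g t) t := by
    rw [integrable_indicator_iff measurableSet_Ioc]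
    refine (ContinuousOn.integrableOn_Icc (ContinuousOn.fun_mul ?_ hgc)).mono_set
      Set.Ioc_subset_Icc_self
    fun_prop
  have h1 : ∫ t in (-a)..b, (E t : ℂ) * g t =
      ∫ t : ℝ, (Set.Ioc (-a) b).indicator (fun t : ℝ => (E t : ℂ) * g t) t := by
    rw [intervalIntegral.integral_of_le (by linarith), integral_indicator measurableSet_Ioc]
  have h2 : (√(2 * Real.pi / c) : ℂ) * ∑ k ∈ Finset.range N,
      PowerSeries.coeff (2 * k) (taylorSeries g) *
        ((2 ^ k * (ascPochhammer ℝ k).eval (1 / 2) / c ^ k : ℝ) : ℂ) =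
      ∫ t : ℝ, ∑ m ∈ Finset.range (2 * N),
        PowerSeries.coeff m (taylorSeries g) * ((t ^ m * E t : ℝ) : ℂ) := by
    rw [integral_finsetSum _ fun m _ => hterm m, sum_range_two_mul, Finset.mul_sum]
    refine Finset.sum_congr rfl fun k _ => ?_
    rw [integral_const_mul, integral_const_mul, integral_complex_ofReal, integral_complex_ofReal, hE,
      integral_odd_pow_mul_gaussian, integral_even_pow_mul_gaussian hc]
    push_cast; ring
  rw [h1, h2, ← integral_sub hmain (integrable_finsetSum _ fun m _ => hterm m)]
  have h3 : C * (2 ^ N * (ascPochhammer ℝ N).eval (1 / 2)) * (√(2 * Real.pi / c) / c ^ N) =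
      ∫ t : ℝ, C * (t ^ (2 * N) * E t) := by
    rw [integral_const_mul, hE, integral_even_pow_mul_gaussian hc]; ring
  rw [h3]
  refine norm_integral_le_of_norm_le ((hmom _).const_mul C) (Eventually.of_forall fun t => ?_)
  have h4 : (Set.Ioc (-a) b).indicator (fun t : ℝ => (E t : ℂ) * g t) t -
      ∑ m ∈ Finset.range (2 * N), PowerSeries.coeff m (taylorSeries g) * ((t ^ m * E t : ℝ) : ℂ) =
      ((Set.Ioc (-a) b).indicator (fun t : ℝ => g t) t -
      ∑ m ∈ Finset.range (2 * N), PowerSeries.coeff m (taylorSeries g) * (t : ℂ) ^ m) * E t := by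
    rw [sub_mul, Finset.sum_mul]
    congr 1
    · by_cases h5 : t ∈ Set.Ioc (-a) b
      · rw [Set.indicator_of_mem h5, Set.indicator_of_mem h5, mul_comm]
      · rw [Set.indicator_of_notMem h5, Set.indicator_of_notMem h5, zero_mul]
    · refine Finset.sum_congr rfl fun m _ => ?_
      push_cast; ring
  have hE0 : 0 < E t := Real.exp_pos _
  have h6 : |t| ^ (2 * N) = t ^ (2 * N) := by rw [pow_mul, sq_abs, ← pow_mul]
  rw [h4, norm_mul, Complex.norm_real, Real.norm_of_nonneg hE0.le, ← mul_assoc, ← h6]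
  exact mul_le_mul_of_nonneg_right (hC t) hE0.le

end

/-! ### The coefficient recursion -/

noncomputable section

open Filter Topology

/-- Recursive solution, through order six, of the power series equations satisfied by the saddle
expansion. -/
theorem coeff_eq_of_saddle_recursion {a t μ : ℂ} (ha : a ≠ 0) {η D R : ℕ → ℂ}
    (hη0 : η 0 = 0) (hη1 : η 1 = a) (hη2 : 2 * η 2 = D 1 + a ^ 2) (hD0 : D 0 = a)
    (hη : ∀ m : ℕ, (m + 3) * η (m + 3) = D (m + 2) + a ^ 2 * t * η (m + 1))
    (hmul : ∀ m : ℕ, ∑ j ∈ Finset.range (m + 2 + 1), η j * D (m + 2 - j) = a ^ 2 * t * η (m + 1))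
    (hR : ∀ m : ℕ, R m = μ * (D m - ∑ j ∈ Finset.range m, R j * (D (m - 1 - j) / (m - j)))) :
    R 0 = a * μ ∧
    R 2 = a ^ 3 * (1/12 * t ^ 2 * μ - t * μ ^ 2 - 1/12 * t * μ + μ ^ 3 + 1/2 * μ ^ 2 + 1/12 * μ) ∧
    R 4 = a ^ 5 * (1/864 * t ^ 4 * μ - 1/36 * t ^ 3 * μ ^ 2 - 1/432 * t ^ 3 * μ + 25/36 * t ^ 2 * μ ^ 3 + 1/24 * t ^ 2 * μ ^ 2 + 1/288 * t ^ 2 * μ - 5/3 * t * μ ^ 4 - 25/36 * t * μ ^ 3 - 7/72 * t * μ ^ 2 - 1/432 * t * μ + μ ^ 5 + 5/6 * μ ^ 4 + 5/18 * μ ^ 3 + 1/24 * μ ^ 2 + 1/864 * μ) ∧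
    R 6 = a ^ 7 * (-139/777600 * t ^ 6 * μ - 1/4320 * t ^ 5 * μ ^ 2 + 139/259200 * t ^ 5 * μ + 49/4320 * t ^ 4 * μ ^ 3 + 1/1728 * t ^ 4 * μ ^ 2 - 67/129600 * t ^ 4 * μ - 77/180 * t ^ 3 * μ ^ 4 - 49/2160 * t ^ 3 * μ ^ 3 - 1/540 * t ^ 3 * μ ^ 2 + 109/777600 * t ^ 3 * μ + 7/4 * t ^ 2 * μ ^ 5 + 77/120 * t ^ 2 * μ ^ 4 + 119/1440 * t ^ 2 * μ ^ 3 + 19/8640 * t ^ 2 * μ ^ 2 - 67/129600 * t ^ 2 * μ - 7/3 * t * μ ^ 6 - 7/4 * t * μ ^ 5 - 21/40 * t * μ ^ 4 - 77/1080 * t * μ ^ 3 - 1/540 * t * μ ^ 2 + 139/259200 * t * μ + μ ^ 7 + 7/6 * μ ^ 6 + 7/12 * μ ^ 5 + 7/45 * μ ^ 4 + 91/4320 * μ ^ 3 + 1/1728 * μ ^ 2 - 139/777600 * μ) := by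
  have m1 := hmul 0
  norm_num [Finset.sum_range_succ, hη0, hη1, hD0] at m1
  have n1 := hη2
  have D1 : D 1 = a ^ 2 * (2/3 * t - 1/3) := by
    apply mul_left_cancel₀ ha
    -- At stage `j` the unknowns are `D j` and `η (j + 1)`. The product equation contains them as `a
    -- * D j + a * η (j + 1)`, and the derivative equation gives `(j + 1) * η (j + 1) = D j + ⋯`.
    -- Eliminating `η (j + 1)` leaves `a (j + 2) / (j + 1) * D j`, whence the multipliers `(j + 1) /
    -- (j + 2)` and `a / (j + 2)` here and below.
    linear_combination (2 / 3 : ℂ) * m1 - (a / 3) * n1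
  have η2 : η 2 = a ^ 2 * (1/3 * t + 1/3) := by
    rw [D1] at n1
    linear_combination (1 / 2 : ℂ) * n1
  have m2 := hmul 1
  norm_num [Finset.sum_range_succ, hη0, hη1, hD0, η2, D1] at m2
  have n2 := hη 0
  norm_num [hη0, hη1, hD0, η2, D1] at n2
  have D2 : D 2 = a ^ 3 * (1/12 * t ^ 2 - 1/12 * t + 1/12) := by
    apply mul_left_cancel₀ ha
    linear_combination (3 / 4 : ℂ) * m2 - (a / 4) * n2
  have η3 : η 3 = a ^ 3 * (1/36 * t ^ 2 + 11/36 * t + 1/36) := by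
    rw [D2] at n2
    linear_combination (1 / 3 : ℂ) * n2
  have m3 := hmul 2
  norm_num [Finset.sum_range_succ, hη0, hη1, hD0, η2, η3, D1, D2] at m3
  have n3 := hη 1
  norm_num [hη0, hη1, hD0, η2, η3, D1, D2] at n3
  have D3 : D 3 = a ^ 4 * (-2/135 * t ^ 3 + 1/45 * t ^ 2 + 1/45 * t - 2/135) := by
    apply mul_left_cancel₀ ha
    linear_combination (4 / 5 : ℂ) * m3 - (a / 5) * n3
  have η4 : η 4 = a ^ 4 * (-1/270 * t ^ 3 + 4/45 * t ^ 2 + 4/45 * t - 1/270) := by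
    rw [D3] at n3
    linear_combination (1 / 4 : ℂ) * n3
  have m4 := hmul 3
  norm_num [Finset.sum_range_succ, hη0, hη1, hD0, η2, η3, η4, D1, D2, D3] at m4
  have n4 := hη 2
  norm_num [hη0, hη1, hD0, η2, η3, η4, D1, D2, D3] at n4
  have D4 : D 4 = a ^ 5 * (1/864 * t ^ 4 - 1/432 * t ^ 3 + 1/288 * t ^ 2 - 1/432 * t + 1/864) := by
    apply mul_left_cancel₀ ha
    linear_combination (5 / 6 : ℂ) * m4 - (a / 6) * n4
  have η5 : η 5 = a ^ 5 * (1/4320 * t ^ 4 + 11/2160 * t ^ 3 + 89/1440 * t ^ 2 + 11/2160 * t + 1/4320) := by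
    rw [D4] at n4
    linear_combination (1 / 5 : ℂ) * n4
  have m5 := hmul 4
  norm_num [Finset.sum_range_succ, hη0, hη1, hD0, η2, η3, η4, η5, D1, D2, D3, D4] at m5
  have n5 := hη 3
  norm_num [hη0, hη1, hD0, η2, η3, η4, η5, D1, D2, D3, D4] at n5
  have D5 : D 5 = a ^ 6 * (1/2835 * t ^ 5 - 1/1134 * t ^ 4 + 1/2835 * t ^ 3 + 1/2835 * t ^ 2 - 1/1134 * t + 1/2835) := by
    apply mul_left_cancel₀ ha
    linear_combination (6 / 7 : ℂ) * m5 - (a / 7) * n5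
  have η6 : η 6 = a ^ 6 * (1/17010 * t ^ 5 - 13/17010 * t ^ 4 + 253/17010 * t ^ 3 + 253/17010 * t ^ 2 - 13/17010 * t + 1/17010) := by
    rw [D5] at n5
    linear_combination (1 / 6 : ℂ) * n5
  have m6 := hmul 5
  norm_num [Finset.sum_range_succ, hη0, hη1, hD0, η2, η3, η4, η5, η6, D1, D2, D3, D4, D5] at m6
  have n6 := hη 4
  norm_num [hη0, hη1, hD0, η2, η3, η4, η5, η6, D1, D2, D3, D4, D5] at n6
  have D6 : D 6 = a ^ 7 * (-139/777600 * t ^ 6 + 139/259200 * t ^ 5 - 67/129600 * t ^ 4 + 109/777600 * t ^ 3 - 67/129600 * t ^ 2 + 139/259200 * t - 139/777600) := by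
    apply mul_left_cancel₀ ha
    linear_combination (7 / 8 : ℂ) * m6 - (a / 8) * n6
  have R0 : R 0 = a ^ 1 * (μ) := by
    rw [hR]
    norm_num [Finset.sum_range_succ, hD0]
    ring
  have R1 : R 1 = a ^ 2 * (2/3 * t * μ - μ ^ 2 - 1/3 * μ) := by
    rw [hR]
    norm_num [Finset.sum_range_succ, hD0, D1, R0]
    ring
  have R2 : R 2 = a ^ 3 * (1/12 * t ^ 2 * μ - t * μ ^ 2 - 1/12 * t * μ + μ ^ 3 + 1/2 * μ ^ 2 + 1/12 * μ) := by
    rw [hR]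
    norm_num [Finset.sum_range_succ, hD0, D1, D2, R0, R1]
    ring
  have R3 : R 3 = a ^ 4 * (-2/135 * t ^ 3 * μ - 1/3 * t ^ 2 * μ ^ 2 + 1/45 * t ^ 2 * μ + 4/3 * t * μ ^ 3 + 1/3 * t * μ ^ 2 + 1/45 * t * μ - μ ^ 4 - 2/3 * μ ^ 3 - 1/6 * μ ^ 2 - 2/135 * μ) := by
    rw [hR]
    norm_num [Finset.sum_range_succ, hD0, D1, D2, D3, R0, R1, R2]
    ring
  have R4 : R 4 = a ^ 5 * (1/864 * t ^ 4 * μ - 1/36 * t ^ 3 * μ ^ 2 - 1/432 * t ^ 3 * μ + 25/36 * t ^ 2 * μ ^ 3 + 1/24 * t ^ 2 * μ ^ 2 + 1/288 * t ^ 2 * μ - 5/3 * t * μ ^ 4 - 25/36 * t * μ ^ 3 - 7/72 * t * μ ^ 2 - 1/432 * t * μ + μ ^ 5 + 5/6 * μ ^ 4 + 5/18 * μ ^ 3 + 1/24 * μ ^ 2 + 1/864 * μ) := by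
    rw [hR]
    norm_num [Finset.sum_range_succ, hD0, D1, D2, D3, D4, R0, R1, R2, R3]
    ring
  have R5 : R 5 = a ^ 6 * (1/2835 * t ^ 5 * μ + 1/270 * t ^ 4 * μ ^ 2 - 1/1134 * t ^ 4 * μ + 22/135 * t ^ 3 * μ ^ 3 - 1/135 * t ^ 3 * μ ^ 2 + 1/2835 * t ^ 3 * μ - 7/6 * t ^ 2 * μ ^ 4 - 11/45 * t ^ 2 * μ ^ 3 - 1/60 * t ^ 2 * μ ^ 2 + 1/2835 * t ^ 2 * μ + 2 * t * μ ^ 5 + 7/6 * t * μ ^ 4 + 23/90 * t * μ ^ 3 + 11/540 * t * μ ^ 2 - 1/1134 * t * μ - μ ^ 6 - μ ^ 5 - 5/12 * μ ^ 4 - 47/540 * μ ^ 3 - 1/135 * μ ^ 2 + 1/2835 * μ) := by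
    rw [hR]
    norm_num [Finset.sum_range_succ, hD0, D1, D2, D3, D4, D5, R0, R1, R2, R3, R4]
    ring
  have R6 : R 6 = a ^ 7 * (-139/777600 * t ^ 6 * μ - 1/4320 * t ^ 5 * μ ^ 2 + 139/259200 * t ^ 5 * μ + 49/4320 * t ^ 4 * μ ^ 3 + 1/1728 * t ^ 4 * μ ^ 2 - 67/129600 * t ^ 4 * μ - 77/180 * t ^ 3 * μ ^ 4 - 49/2160 * t ^ 3 * μ ^ 3 - 1/540 * t ^ 3 * μ ^ 2 + 109/777600 * t ^ 3 * μ + 7/4 * t ^ 2 * μ ^ 5 + 77/120 * t ^ 2 * μ ^ 4 + 119/1440 * t ^ 2 * μ ^ 3 + 19/8640 * t ^ 2 * μ ^ 2 - 67/129600 * t ^ 2 * μ - 7/3 * t * μ ^ 6 - 7/4 * t * μ ^ 5 - 21/40 * t * μ ^ 4 - 77/1080 * t * μ ^ 3 - 1/540 * t * μ ^ 2 + 139/259200 * t * μ + μ ^ 7 + 7/6 * μ ^ 6 + 7/12 * μ ^ 5 + 7/45 * μ ^ 4 + 91/4320 * μ ^ 3 + 1/1728 * μ ^ 2 - 139/777600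 * μ) := by
    rw [hR]
    norm_num [Finset.sum_range_succ, hD0, D1, D2, D3, D4, D5, D6, R0, R1, R2, R3, R4, R5]
    ring
  exact ⟨by rw [R0]; ring, R2, R4, R6⟩

end

/-! ### The differential system for the saddle germ, and assembly of the expansion -/

noncomputable section

open Filter Topology

section
variable {x : ℝ}

/-- Differentiating the phase equation gives `ψ'(s) s' = w`. In terms of `η = e^s / h - 1` one has
`e^s - 1 = (h - 1)(1 + xη)`, so `ψ'(s) = x (1 - x) η / (1 + xη)`, and `x (1 - x)` is the inverse
square of the slope. The equation becomes polynomial in `η` and `s'`. -/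
theorem IsSaddleInverse.eventually_deriv (hx : 1 < x) {s : ℂ → ℂ} (hs : IsSaddleInverse x s) :
    ∀ᶠ w in 𝓝 0, (Complex.exp (s w) / hPar x - 1) * deriv s w =
      saddleSlope x ^ 2 * (w * (1 + x * (Complex.exp (s w) / hPar x - 1))) := by
  have h1 := one_lt_hPar hx
  have ht : Tendsto s (𝓝 0) (𝓝 (saddlePt x : ℂ)) := by
    have := hs.analyticAt.continuousAt.tendsto
    rwa [hs.map_zero] at this
  filter_upwards [hs.phase_eq.eventually_nhds, hs.analyticAt.eventually_analyticAt,
    ht.eventually (eventually_mem_slitPlane hx)] with w e1 e2 e3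
  have d1 : HasDerivAt (fun w => phase x (s w) - phase x (saddlePt x))
      ((Complex.exp (s w) / (Complex.exp (s w) - 1) - x) * deriv s w) w :=
    (HasDerivAt.comp w (hasDerivAt_phase e3) e2.differentiableAt.hasDerivAt).sub_const _
  have d2 : HasDerivAt (fun w : ℂ => w ^ 2 / 2) w w :=
    ((hasDerivAt_pow 2 w).div_const 2).congr_deriv (by push_cast; ring)
  have d3 : deriv (fun w => phase x (s w) - phase x (saddlePt x)) w = deriv (fun w => w ^ 2 / 2) w :=
    Filter.EventuallyEq.deriv_eq e1
  rw [d1.deriv, d2.deriv] at d3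
  have hne := Complex.slitPlane_ne_zero e3
  have hh0 : (hPar x : ℂ) ≠ 0 := Complex.ofReal_ne_zero.2 (by linarith)
  have hh1 : (hPar x : ℂ) - 1 ≠ 0 := by
    rw [← Complex.ofReal_one, ← Complex.ofReal_sub]; exact Complex.ofReal_ne_zero.2 (by linarith)
  have hxh : (x : ℂ) = hPar x / (hPar x - 1) := by exact_mod_cast eq_hPar_div hx
  generalize Complex.exp (s w) = E at d3 hne ⊢
  generalize deriv s w = d at d3 ⊢
  rw [saddleSlope_sq hx, ← d3, hxh]
  field_simp
  ring

/-- The even Taylor coefficients of `s' / s` through order six. -/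
theorem IsSaddleInverse.logDerivCoeff_even (hx : 1 < x) {s : ℂ → ℂ} (hs : IsSaddleInverse x s) :
    let a := saddleSlope x
    let t : ℂ := x
    let μ : ℂ := (saddlePt x : ℂ)⁻¹
    logDerivCoeff s 0 = a * μ ∧
    logDerivCoeff s 2 = a ^ 3 * (1/12 * t ^ 2 * μ - t * μ ^ 2 - 1/12 * t * μ + μ ^ 3 + 1/2 * μ ^ 2 + 1/12 * μ) ∧
    logDerivCoeff s 4 = a ^ 5 * (1/864 * t ^ 4 * μ - 1/36 * t ^ 3 * μ ^ 2 - 1/432 * t ^ 3 * μ + 25/36 * t ^ 2 * μ ^ 3 + 1/24 * t ^ 2 * μ ^ 2 + 1/288 * t ^ 2 * μ - 5/3 * t * μ ^ 4 - 25/36 * t * μ ^ 3 - 7/72 * t * μ ^ 2 - 1/432 * t * μ + μ ^ 5 + 5/6 * μ ^ 4 + 5/18 * μ ^ 3 + 1/24 * μ ^ 2 + 1/864 * μ) ∧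
    logDerivCoeff s 6 = a ^ 7 * (-139/777600 * t ^ 6 * μ - 1/4320 * t ^ 5 * μ ^ 2 + 139/259200 * t ^ 5 * μ + 49/4320 * t ^ 4 * μ ^ 3 + 1/1728 * t ^ 4 * μ ^ 2 - 67/129600 * t ^ 4 * μ - 77/180 * t ^ 3 * μ ^ 4 - 49/2160 * t ^ 3 * μ ^ 3 - 1/540 * t ^ 3 * μ ^ 2 + 109/777600 * t ^ 3 * μ + 7/4 * t ^ 2 * μ ^ 5 + 77/120 * t ^ 2 * μ ^ 4 + 119/1440 * t ^ 2 * μ ^ 3 + 19/8640 * t ^ 2 * μ ^ 2 - 67/129600 * t ^ 2 * μ - 7/3 * t * μ ^ 6 - 7/4 * t * μ ^ 5 - 21/40 * t * μ ^ 4 - 77/1080 * t * μ ^ 3 - 1/540 * t * μ ^ 2 + 139/259200 * t * μ + μ ^ 7 + 7/6 * μ ^ 6 + 7/12 * μ ^ 5 + 7/45 * μ ^ 4 + 91/4320 * μ ^ 3 + 1/1728 * μ ^ 2 - 139/777600 * μ) := by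
  have h1 := one_lt_hPar hx
  have hh0 : (hPar x : ℂ) ≠ 0 := Complex.ofReal_ne_zero.2 (by linarith)
  have hl0 : (saddlePt x : ℂ) ≠ 0 := Complex.ofReal_ne_zero.2 (saddlePt_pos hx).ne'
  set η : ℂ → ℂ := fun w => Complex.exp (s w) / hPar x - 1 with hη
  have hsa := hs.analyticAt
  have hda := hs.analyticAt.deriv
  have hηa : AnalyticAt ℂ η 0 := by fun_prop
  have hmulS : taylorSeries η * taylorSeries (deriv s) = PowerSeries.C (saddleSlope x ^ 2) *
      (PowerSeries.X * (1 + PowerSeries.C (x : ℂ) * taylorSeries η)) := by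
    rw [← taylorSeries_mul hηa hda, taylorSeries_congr (hs.eventually_deriv hx),
      taylorSeries_mul (by fun_prop) (by fun_prop),
      taylorSeries_mul (f := fun w => w) (by fun_prop) (by fun_prop),
      taylorSeries_add (by fun_prop) (by fun_prop),
      taylorSeries_mul (by fun_prop) hηa, taylorSeries_const, taylorSeries_const,
      taylorSeries_const, taylorSeries_id, map_one]
  -- Since `η' = (1 + η) s'`, substituting the previous equation for `η s'` keeps this one linear in
  -- the unknown series.
  have hderS : taylorSeries (deriv η) = taylorSeries (deriv s) + PowerSeries.C (saddleSlope x ^ 2) *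
      (PowerSeries.X * (1 + PowerSeries.C (x : ℂ) * taylorSeries η)) := by
    rw [← hmulS, ← taylorSeries_mul hηa hda, ← taylorSeries_add hda (by fun_prop)]
    refine taylorSeries_congr ?_
    filter_upwards [hsa.eventually_analyticAt] with w hw
    have := (hw.differentiableAt.hasDerivAt.cexp.div_const (hPar x : ℂ)).sub_const 1
    refine this.deriv.trans ?_
    simp only [hη]
    ring
  have hRS : taylorSeries (fun w => (1 / s w) * deriv s w) * taylorSeries s =
      taylorSeries (deriv s) := by
    rw [← taylorSeries_mul (hs.analyticAt_logDeriv hx) hsa]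
    refine taylorSeries_congr ?_
    have : ∀ᶠ w in 𝓝 0, s w ≠ 0 :=
      hsa.continuousAt.eventually_ne (by rw [hs.map_zero]; exact hl0)
    filter_upwards [this] with w hw
    field_simp
  have hη0 : PowerSeries.coeff 0 (taylorSeries η) = 0 := by
    rw [PowerSeries.coeff_zero_eq_constantCoeff_apply, constantCoeff_taylorSeries, hη]
    simp only
    rw [hs.map_zero, cexp_saddlePt hx, div_self hh0, sub_self]
  have hD0 : PowerSeries.coeff 0 (taylorSeries (deriv s)) = saddleSlope x := by
    rw [PowerSeries.coeff_zero_eq_constantCoeff_apply, constantCoeff_taylorSeries, hs.deriv_zero]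
    rfl
  have hs0 : PowerSeries.coeff 0 (taylorSeries s) = saddlePt x := by
    rw [PowerSeries.coeff_zero_eq_constantCoeff_apply, constantCoeff_taylorSeries, hs.map_zero]
  have hder : ∀ m, (m + 1) * PowerSeries.coeff (m + 1) (taylorSeries η) =
      PowerSeries.coeff m (taylorSeries (deriv s)) + saddleSlope x ^ 2 *
      PowerSeries.coeff m (PowerSeries.X * (1 + PowerSeries.C (x : ℂ) * taylorSeries η)) := by
    intro m
    rw [← coeff_taylorSeries_deriv, hderS, map_add, PowerSeries.coeff_C_mul]
  refine coeff_eq_of_saddle_recursion (saddleSlope_ne_zero hx)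
    (η := fun m => PowerSeries.coeff m (taylorSeries η))
    (D := fun m => PowerSeries.coeff m (taylorSeries (deriv s)))
    (R := fun m => logDerivCoeff s m) hη0 ?_ ?_ hD0 ?_ ?_ ?_
  · have := hder 0
    rw [hD0] at this
    simpa using this
  · have := hder 1
    rw [PowerSeries.coeff_succ_X_mul, map_add, PowerSeries.coeff_C_mul, hη0] at this
    norm_num at this
    simpa using this
  · intro m
    have := hder (m + 2)
    rw [PowerSeries.coeff_succ_X_mul, map_add, PowerSeries.coeff_C_mul,
      PowerSeries.coeff_one, if_neg (by omega)] at this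
    push_cast at this
    rw [show m + 2 + 1 = m + 3 from rfl] at this
    linear_combination this
  · intro m
    have := congrArg (PowerSeries.coeff (m + 2)) hmulS
    rw [PowerSeries.coeff_mul, Finset.Nat.sum_antidiagonal_eq_sum_range_succ_mk,
      PowerSeries.coeff_C_mul, PowerSeries.coeff_succ_X_mul, map_add, PowerSeries.coeff_C_mul,
      PowerSeries.coeff_one, if_neg (by omega)] at this
    simp only at this ⊢
    rw [this]
    ring
  · intro m
    have := congrArg (PowerSeries.coeff m) hRS
    rw [PowerSeries.coeff_mul, Finset.Nat.sum_antidiagonal_eq_sum_range_succ_mk,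
      Finset.sum_range_succ] at this
    simp only [Nat.sub_self, hs0] at this
    rw [← this]
    have hsum : ∑ j ∈ Finset.range m,
        PowerSeries.coeff j (taylorSeries fun w => (1 / s w) * deriv s w) *
          PowerSeries.coeff (m - j) (taylorSeries s) =
        ∑ j ∈ Finset.range m, logDerivCoeff s j *
          (PowerSeries.coeff (m - 1 - j) (taylorSeries (deriv s)) / (m - j)) := by
      refine Finset.sum_congr rfl fun j hj => ?_
      obtain ⟨k, rfl⟩ := Nat.exists_eq_add_of_lt (Finset.mem_range.1 hj)
      rw [show j + k + 1 - 1 - j = k by omega, show j + k + 1 - j = k + 1 by omega,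
        coeff_taylorSeries_deriv, coeff_taylorSeries]
      have h5 : (k : ℂ) + 1 ≠ 0 := by exact_mod_cast k.succ_ne_zero
      have h6 : ((j + k + 1 : ℕ) : ℂ) - j = k + 1 := by push_cast; ring
      rw [h6, logDerivCoeff]
      field_simp
    rw [hsum, add_sub_cancel_left, coeff_taylorSeries, logDerivCoeff]
    field_simp

/-- The normalising factor of the even Taylor coefficients of `s' / s`. -/
def saddleScale (x : ℝ) : ℝ := (hPar x - 1) / (saddlePt x * √(hPar x))

theorem saddleScale_pos (hx : 1 < x) : 0 < saddleScale x := by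
  have h1 := one_lt_hPar hx
  exact div_pos (by linarith) (mul_pos (saddlePt_pos hx) (Real.sqrt_pos.2 (by linarith)))

theorem I_mul_saddleScale :
    Complex.I * (saddleScale x : ℂ) = saddleSlope x * (saddlePt x : ℂ)⁻¹ := by
  rw [saddleScale, saddleSlope]
  push_cast
  rw [div_mul_eq_div_div_swap, div_eq_mul_inv _ (saddlePt x : ℂ)]
  ring

theorem prefactor_eq (hx : 1 < x) (n : ℕ) :
    prefactor x n = (n.factorial : ℝ) / ((hPar x - 1) / hPar x ^ x) ^ n *
      (saddleScale x / √(2 * Real.pi * n)) := by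
  have h1 := one_lt_hPar hx
  have h0 : 0 < hPar x := by linarith
  have hx1 : x - 1 ≠ 0 := by linarith
  have hh : hPar x - 1 = (x - 1)⁻¹ := by rw [hPar]; field_simp; ring
  have hl := (saddlePt_pos hx).ne'
  have e1 : Real.log (x / (x - 1)) = saddlePt x := rfl
  have e2 : x / (x - 1) = hPar x := rfl
  have e3 : hPar x ^ ((n : ℝ) * x - 1 / 2) = (hPar x ^ x) ^ n / √(hPar x) := by
    rw [Real.rpow_sub h0, ← Real.sqrt_eq_rpow, mul_comm, Real.rpow_mul h0.le, Real.rpow_natCast]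
  have e4 : (x - 1) ^ ((n : ℤ) - 1) = (x - 1) ^ n / (x - 1) := by
    rw [zpow_sub₀ hx1, zpow_natCast, zpow_one]
  have h2 : hPar x ^ x ≠ 0 := (Real.rpow_pos_of_pos h0 _).ne'
  have h3 : √(hPar x) ≠ 0 := (Real.sqrt_pos.2 h0).ne'
  rw [prefactor, e1, e2, e3, e4, saddleScale, hh]
  simp only [div_pow, inv_pow]
  field_simp

/-- The recursion produces polynomials in `x` and `1 / s₀`; substituting `x = h / (h - 1)` and `a² =
-(h - 1)² / h` turns them into the formulas in `h`. -/
theorem ofReal_explicit_eq (hx : 1 < x) :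
    let a := saddleSlope x
    let t : ℂ := x
    let μ : ℂ := (saddlePt x : ℂ)⁻¹
    a ^ 3 * (1/12 * t ^ 2 * μ - t * μ ^ 2 - 1/12 * t * μ + μ ^ 3 + 1/2 * μ ^ 2 + 1/12 * μ) = a * μ * (explicitA1 (hPar x) (saddlePt x) : ℂ) ∧
    a ^ 5 * (1/864 * t ^ 4 * μ - 1/36 * t ^ 3 * μ ^ 2 - 1/432 * t ^ 3 * μ + 25/36 * t ^ 2 * μ ^ 3 + 1/24 * t ^ 2 * μ ^ 2 + 1/288 * t ^ 2 * μ - 5/3 * t * μ ^ 4 - 25/36 * t * μ ^ 3 - 7/72 * t * μ ^ 2 - 1/432 * t * μ + μ ^ 5 + 5/6 * μ ^ 4 + 5/18 * μ ^ 3 + 1/24 * μ ^ 2 + 1/864 * μ) = a * μ * (explicitA2 (hPar x) (saddlePt x) : ℂ) ∧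
    a ^ 7 * (-139/777600 * t ^ 6 * μ - 1/4320 * t ^ 5 * μ ^ 2 + 139/259200 * t ^ 5 * μ + 49/4320 * t ^ 4 * μ ^ 3 + 1/1728 * t ^ 4 * μ ^ 2 - 67/129600 * t ^ 4 * μ - 77/180 * t ^ 3 * μ ^ 4 - 49/2160 * t ^ 3 * μ ^ 3 - 1/540 * t ^ 3 * μ ^ 2 + 109/777600 * t ^ 3 * μ + 7/4 * t ^ 2 * μ ^ 5 + 77/120 * t ^ 2 * μ ^ 4 + 119/1440 * t ^ 2 * μ ^ 3 + 19/8640 * t ^ 2 * μ ^ 2 - 67/129600 * t ^ 2 * μ - 7/3 * t * μ ^ 6 - 7/4 * t * μ ^ 5 - 21/40 * t * μ ^ 4 - 77/1080 * t * μ ^ 3 - 1/540 * t * μ ^ 2 + 139/259200 * t * μ + μ ^ 7 + 7/6 * μ ^ 6 + 7/12 * μ ^ 5 + 7/45 * μ ^ 4 + 91/4320 * μ ^ 3 + 1/1728 * μ ^ 2 - 139/777600 * μ) = a * μ * (explicitA3 (hPar x) (saddlePt x) : ℂ) := by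
  intro a t μ
  have h1 := one_lt_hPar hx
  have hl0 : (saddlePt x : ℂ) ≠ 0 := Complex.ofReal_ne_zero.2 (saddlePt_pos hx).ne'
  have hh0 : (hPar x : ℂ) ≠ 0 := Complex.ofReal_ne_zero.2 (by linarith)
  have hh1 : (hPar x : ℂ) - 1 ≠ 0 := by
    rw [← Complex.ofReal_one, ← Complex.ofReal_sub]; exact Complex.ofReal_ne_zero.2 (by linarith)
  have hxh : (x : ℂ) = hPar x / (hPar x - 1) := by exact_mod_cast eq_hPar_div hx
  have ha2 : a ^ 2 = -((hPar x : ℂ) - 1) ^ 2 / hPar x := saddleSlope_sq hx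
  have ha3 : a ^ 3 = a * (a ^ 2) := by ring
  have ha5 : a ^ 5 = a * (a ^ 2) ^ 2 := by ring
  have ha7 : a ^ 7 = a * (a ^ 2) ^ 3 := by ring
  refine ⟨?_, ?_, ?_⟩
  · rw [ha3, ha2, show t = _ from hxh, explicitA1]
    simp only [μ]
    push_cast
    field_simp
    ring
  · rw [ha5, ha2, show t = _ from hxh, explicitA2]
    simp only [μ]
    push_cast
    field_simp
    ring
  · rw [ha7, ha2, show t = _ from hxh, explicitA3]
    simp only [μ]
    push_cast
    field_simp
    ring

theorem isBigO_genBernoulli (hx : 1 < x) {s : ℂ → ℂ} (hs : IsSaddleInverse x s) {A : ℕ → ℝ}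
    (hA : ∀ k, logDerivCoeff s (2 * k) = Complex.I * (saddleScale x : ℂ) * (A k : ℂ)) (N : ℕ) :
    (fun n : ℕ => genBernoulli n n ((n : ℝ) * x)
        - prefactor x n * ∑ k ∈ Finset.range N,
            2 ^ k * (ascPochhammer ℝ k).eval (1 / 2) / (n : ℝ) ^ k * A k)
      =O[atTop] fun n : ℕ => prefactor x n / (n : ℝ) ^ N := by
  have hc := saddleScale_pos hx
  have h1 := one_lt_hPar hx
  have hK : 0 < (hPar x - 1) / hPar x ^ x :=
    div_pos (by linarith) (Real.rpow_pos_of_pos (by linarith) _)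
  have hpi := Real.pi_pos
  obtain ⟨ε, a, b, hε0, hε1, ha, hb, hgc, hgs⟩ := hs.exists_geomSmall_sub_gaussian hx
  have hG := (geomSmall_sub_saddleIntegral hx hε0 hε1).add hgs
  obtain ⟨C, hC⟩ := exists_gaussian_expansion (hs.analyticAt_logDeriv hx) ha hb hgc N
  set K := (hPar x - 1) / hPar x ^ x with hKdef
  set c := saddleScale x with hcdef
  set α : ℕ → ℝ := fun n => genBernoulli n n (n * x) / n.factorial with hα
  have hcoef : ∀ n : ℕ, PowerSeries.coeff n (taylorSeries (genBernoulliFun n (n * x))) =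
      (α n : ℂ) := fun n => by
    have h2 : (n.factorial : ℂ) ≠ 0 := by exact_mod_cast n.factorial_ne_zero
    simp only [hα]
    push_cast
    rw [genBernoulli_eq_taylorSeries]
    field_simp
  set T : ℕ → ℝ := fun n => ∑ k ∈ Finset.range N,
    2 ^ k * (ascPochhammer ℝ k).eval (1 / 2) / (n : ℝ) ^ k * A k with hT
  -- The target error is itself a power of `n`, so the geometrically small errors are absorbed into
  -- it.
  have hrpow : (fun n : ℕ => (n : ℝ) ^ (-(N : ℝ) - 1 / 2)) =O[atTop]
      fun n : ℕ => 1 / √(2 * Real.pi * n) / (n : ℝ) ^ N := by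
    refine Asymptotics.IsBigO.of_bound √(2 * Real.pi) ?_
    filter_upwards [eventually_ge_atTop 1] with n hn
    have hn0 : (0 : ℝ) < n := by exact_mod_cast hn
    rw [Real.norm_of_nonneg (by positivity), Real.norm_of_nonneg (by positivity),
      Real.rpow_sub hn0, Real.rpow_neg hn0.le, Real.rpow_natCast, ← Real.sqrt_eq_rpow,
      Real.sqrt_mul (show 0 ≤ 2 * Real.pi by positivity) n]
    have h3 : √(2 * Real.pi) ≠ 0 := (Real.sqrt_pos.2 (by positivity)).ne'
    have h4 : √(n : ℝ) ≠ 0 := (Real.sqrt_pos.2 hn0).ne'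
    refine le_of_eq ?_
    field_simp
  -- This is Laplace's method at `c = n`. Writing `√(2π / n)` as `2π / √(2πn)` exposes the `2πi`
  -- that the residue theorem also carries.
  have hgauss : (fun n : ℕ => (∫ t in (-a)..b, Complex.exp (-((t : ℂ) ^ 2 / 2)) ^ n *
      ((1 / s t) * deriv s t)) - 2 * Real.pi * Complex.I *
        ((c / √(2 * Real.pi * n) * T n : ℝ) : ℂ)) =O[atTop]
      fun n : ℕ => 1 / √(2 * Real.pi * n) / (n : ℝ) ^ N := by
    refine Asymptotics.IsBigO.of_bound (C * (2 * Real.pi)) ?_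
    filter_upwards [eventually_ge_atTop 1] with n hn
    have hn0 : (0 : ℝ) < n := by exact_mod_cast hn
    have hsq : √(2 * Real.pi / n) = 2 * Real.pi / √(2 * Real.pi * n) := by
      rw [eq_div_iff (Real.sqrt_pos.2 (by positivity)).ne', ← Real.sqrt_mul (by positivity),
        show 2 * Real.pi / n * (2 * Real.pi * n) = (2 * Real.pi) ^ 2 by field_simp,
        Real.sqrt_sq (by positivity)]
    have h3 := hC n hn0
    have h4 : ∀ t : ℝ, (Real.exp (-((n : ℝ) / 2) * t ^ 2) : ℂ) =
        Complex.exp (-((t : ℂ) ^ 2 / 2)) ^ n := fun t => by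
      rw [← Complex.exp_nat_mul, Complex.ofReal_exp]
      congr 1
      push_cast
      ring
    simp only [h4, hsq] at h3
    rw [Real.norm_of_nonneg (by positivity)]
    have h5 : ((2 * Real.pi / √(2 * Real.pi * n) : ℝ) : ℂ) * ∑ k ∈ Finset.range N,
        PowerSeries.coeff (2 * k) (taylorSeries fun w => (1 / s w) * deriv s w) *
          ((2 ^ k * (ascPochhammer ℝ k).eval (1 / 2) / (n : ℝ) ^ k : ℝ) : ℂ) =
        2 * Real.pi * Complex.I * ((c / √(2 * Real.pi * n) * T n : ℝ) : ℂ) := by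
      have h6 : ∀ k, PowerSeries.coeff (2 * k) (taylorSeries fun w => (1 / s w) * deriv s w) =
          Complex.I * (c : ℂ) * (A k : ℂ) := fun k => by rw [← hA k, coeff_taylorSeries]; rfl
      simp only [h6, hT]
      rw [Finset.mul_sum, Finset.mul_sum, Complex.ofReal_sum, Finset.mul_sum]
      refine Finset.sum_congr rfl fun k _ => ?_
      push_cast
      ring
    rw [h5] at h3
    refine h3.trans (le_of_eq ?_)
    ring
  have htotal : (fun n : ℕ => 2 * Real.pi * Complex.I *
      ((K ^ n * α n - c / √(2 * Real.pi * n) * T n : ℝ) : ℂ)) =O[atTop]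
      fun n : ℕ => 1 / √(2 * Real.pi * n) / (n : ℝ) ^ N := by
    refine ((hG.isBigO _).trans hrpow |>.add hgauss).congr_left fun n => ?_
    rw [hcoef]
    push_cast
    ring
  have hreal : (fun n : ℕ => K ^ n * α n - c / √(2 * Real.pi * n) * T n) =O[atTop]
      fun n : ℕ => c / √(2 * Real.pi * n) / (n : ℝ) ^ N := by
    obtain ⟨D, hD⟩ := htotal.bound
    refine Asymptotics.IsBigO.of_bound (D / (2 * Real.pi * c)) ?_
    filter_upwards [hD] with n hn
    rw [norm_mul, norm_mul, norm_mul, Complex.norm_I, Complex.norm_real, Complex.norm_real,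
      Real.norm_of_nonneg hpi.le, Complex.norm_ofNat, mul_one,
      Real.norm_of_nonneg (by positivity : (0 : ℝ) ≤ 1 / √(2 * Real.pi * n) / (n : ℝ) ^ N)] at hn
    rw [Real.norm_of_nonneg (by positivity : (0 : ℝ) ≤ c / √(2 * Real.pi * n) / (n : ℝ) ^ N)]
    rw [← mul_le_mul_iff_right₀ (show 0 < 2 * Real.pi by positivity)]
    refine hn.trans (le_of_eq ?_)
    field_simp
  -- Multiplying by `n! / K ^ n` undoes both normalisations at once and recreates `prefactor`.
  have hfin := (Asymptotics.isBigO_refl (fun n : ℕ => (n.factorial : ℝ) / K ^ n) atTop).mul hreal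
  refine (hfin.congr_left fun n => ?_).congr_right fun n => ?_
  · have h2 : (n.factorial : ℝ) ≠ 0 := by exact_mod_cast n.factorial_ne_zero
    have h3 : K ^ n ≠ 0 := (pow_pos hK n).ne'
    rw [prefactor_eq hx, mul_sub, hα, ← hKdef, ← hcdef]
    congr 1
    · field_simp
    · exact (mul_assoc _ _ _).symm
  · rw [prefactor_eq hx, ← hKdef, ← hcdef]
    ring

end

end
-- The main theorem
theorem theorem1 (x : ℝ) (hx : 1 < x) :
    ∃ A : ℕ → ℝ,
      -- the saddle-point expansion can be inverted, and `A k` are the normalised coefficients of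
      -- the even powers in `(1/s) ds/dw = (i (h - 1) / (s₀ √h)) (A 0 + A 1 w^2 + A 2 w^4 + ...)`
      (∃ s : ℂ → ℂ, IsSaddleInverse x s) ∧
      (∀ s : ℂ → ℂ, IsSaddleInverse x s → ∀ k : ℕ,
        logDerivCoeff s (2 * k) =
          Complex.I * (((hPar x - 1) / (saddlePt x * √(hPar x)) : ℝ) : ℂ) * (A k : ℂ)) ∧
      A 0 = 1 ∧
      A 1 = explicitA1 (hPar x) (saddlePt x) ∧
      A 2 = explicitA2 (hPar x) (saddlePt x) ∧
      A 3 = explicitA3 (hPar x) (saddlePt x) ∧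
      -- the complete asymptotic expansion
      ∀ N : ℕ,
        (fun n : ℕ => genBernoulli n n ((n : ℝ) * x)
            - prefactor x n * ∑ k ∈ Finset.range N,
                2 ^ k * (ascPochhammer ℝ k).eval (1 / 2) / (n : ℝ) ^ k * A k)
          =O[Filter.atTop] fun n : ℕ => prefactor x n / (n : ℝ) ^ N := by
  obtain ⟨s, hs⟩ := exists_isSaddleInverse hx
  have hc : (saddleScale x : ℂ) ≠ 0 := Complex.ofReal_ne_zero.2 (saddleScale_pos hx).ne'
  -- The even coefficients have zero real part, so the imaginary part over the scale is a faithful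
  -- real choice of `A k`; by uniqueness of the germ it serves every `s`.
  have hA : ∀ k, logDerivCoeff s (2 * k) = Complex.I * (saddleScale x : ℂ) *
      (((logDerivCoeff s (2 * k)).im / saddleScale x : ℝ) : ℂ) := fun k => by
    push_cast
    rw [mul_assoc, mul_div_cancel₀ _ hc]
    apply Complex.ext
    · simp [hs.logDerivCoeff_re hx k]
    · simp
  have heq : ∀ (k : ℕ) (r : ℝ),
      logDerivCoeff s (2 * k) = saddleSlope x * (saddlePt x : ℂ)⁻¹ * (r : ℂ) →
      (logDerivCoeff s (2 * k)).im / saddleScale x = r := fun k r h => by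
    rw [← I_mul_saddleScale, hA k] at h
    exact Complex.ofReal_injective (mul_left_cancel₀ (mul_ne_zero Complex.I_ne_zero hc) h)
  obtain ⟨c0, c1, c2, c3⟩ := hs.logDerivCoeff_even hx
  obtain ⟨e1, e2, e3⟩ := ofReal_explicit_eq hx
  refine ⟨fun k => (logDerivCoeff s (2 * k)).im / saddleScale x, ⟨s, hs⟩, fun s' hs' k => ?_,
    heq 0 1 (c0.trans (by simp)), heq 1 _ (c1.trans e1), heq 2 _ (c2.trans e2),
    heq 3 _ (c3.trans e3), fun N => isBigO_genBernoulli hx hs hA N⟩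
  rw [hs'.logDerivCoeff_eq hx hs]
  exact hA k
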